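/- Let $0<\gamma<\infty$. Then there exists an exponent $\alpha=\alpha(\gamma)\in(0,1)$, depending only on $\gamma$, with the following property. Let $\Omega\subset\mathbb{R}^2$ be open and bounded with Lipschitz boundary ($\partial\Omega\in C^{0,1}$). Let $s_0\ge 0$ and $\kappa\ge-\gamma s_0$ be constants, and let $\rho\in C^\infty(\mathbb{R})$ satisfy $\rho(s)=0$ for $s\le 0$, $\rho(s)=\gamma s+\kappa$ for $s\ge s_0$, and $\rho$ convex on $[0,s_0]$. For $u_0\in L^2(\partial\Omega,\mathbb{R}^2)$ set $$\mathcal{A}_{u_0}=\{u\in W^{1,2}(\Omega,\mathbb{R}^2): u=u_0 \text{ on } \partial\Omega \text{ in the trace sense}\}.$$ Let $u\in\mathcal{A}_{u_0}$ be a stationary point of $$I(u)=\int_\Omega \tfrac12|\nabla u|^2+\rho(\det\nabla u)\,dx ,$$ that is, let $u$ satisfy the weak Euler–Lagrange equation $$\int_\Omega\bigl(\nabla u+\rho'(\det\nabla u)\,\operatorname{cof}\nabla u\bigr)\cdot\nabla\varphi\,dx=0\qquad\text{for all }\varphi\in W^{1,2}_0(\Omega,\mathbb{R}^2),$$ where $\operatorname{cof}A=(\operatorname{adj}A)^T$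 and $A\cdot B=\sum_{i,j}A_{ij}B_{ij}$. Then $u\in C^{0,\alpha}_{\mathrm{loc}}(\Omega,\mathbb{R}^2)$, i.e. $u$ has a representative that is Hölder continuous with exponent $\alpha$ on every compact subset of $\Omega$. -/

import Mathlib

open Set Filter Topology MeasureTheory
open scoped NNReal ENNReal Matrix ContDiff

/-- The Euclidean plane, both as the space containing the domain and as the target. -/
abbrev Plane : Type := EuclideanSpace ℝ (Fin 2)

/-- Lipschitz boundary (`∂Ω ∈ C^{0,1}`): near every boundary point, after a rigid motion `e`
of the plane, the set `Ω` is exactly the region strictly above the graph of a Lipschitz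
function. -/
def HasLipschitzBoundary (Ω : Set Plane) : Prop :=
  ∀ x₀ ∈ frontier Ω, ∃ (e : Plane ≃ᵃⁱ[ℝ] Plane) (K : ℝ≥0) (f : ℝ → ℝ) (r : ℝ),
    LipschitzWith K f ∧ 0 < r ∧
      ∀ x ∈ Metric.ball x₀ r, x ∈ Ω ↔ f (e x 0) < e x 1

/-- The classical Jacobian matrix `(∂ⱼ ψᵢ)ᵢⱼ` of a differentiable map. -/
noncomputable def jacobianMatrix (ψ : Plane → Plane) (x : Plane) : Matrix (Fin 2) (Fin 2) ℝ :=
  Matrix.of fun i j => fderiv ℝ ψ x (EuclideanSpace.single j 1) i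

/-- `u ∈ W^{1,2}(Ω, ℝ²)` with weak gradient `G`, where `G x i j` is the weak partial
derivative `∂ⱼ uᵢ` at `x`. -/
structure IsSobolevWithGrad (Ω : Set Plane) (u : Plane → Plane)
    (G : Plane → Matrix (Fin 2) (Fin 2) ℝ) : Prop where
  memLp : MemLp u 2 (volume.restrict Ω)
  memLp_grad : ∀ i j, MemLp (fun x => G x i j) 2 (volume.restrict Ω)
  weak_deriv : ∀ (i j : Fin 2) (ζ : Plane → ℝ), ContDiff ℝ ∞ ζ → HasCompactSupport ζ →
    tsupport ζ ⊆ Ω →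
    ∫ x in Ω, u x i * fderiv ℝ ζ x (EuclideanSpace.single j 1) = - ∫ x in Ω, G x i j * ζ x

/-- Convergence in `W^{1,2}(Ω, ℝ²)` of the smooth maps `ψ n` to the map `u` with weak
gradient `G`. -/
def TendstoSobolev (Ω : Set Plane) (ψ : ℕ → Plane → Plane) (u : Plane → Plane)
    (G : Plane → Matrix (Fin 2) (Fin 2) ℝ) : Prop :=
  Tendsto (fun n => eLpNorm (fun x => ψ n x - u x) 2 (volume.restrict Ω)) atTop (𝓝 0) ∧
  ∀ i j, Tendsto
    (fun n => eLpNorm (fun x => jacobianMatrix (ψ n) x i j - G x i j) 2 (volume.restrict Ω))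
    atTop (𝓝 0)

/-- `φ ∈ W₀^{1,2}(Ω, ℝ²)` with weak gradient `H`: `W₀^{1,2}` is the closure of
`C_c^∞(Ω, ℝ²)` in `W^{1,2}(Ω, ℝ²)`. -/
def IsSobolevZeroWithGrad (Ω : Set Plane) (φ : Plane → Plane)
    (H : Plane → Matrix (Fin 2) (Fin 2) ℝ) : Prop :=
  IsSobolevWithGrad Ω φ H ∧
  ∃ ψ : ℕ → Plane → Plane,
    (∀ n, ContDiff ℝ ∞ (ψ n) ∧ HasCompactSupport (ψ n) ∧ tsupport (ψ n) ⊆ Ω) ∧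
    TendstoSobolev Ω ψ φ H

/-- The map `u ∈ W^{1,2}(Ω, ℝ²)`, with weak gradient `G`, equals `u₀` on `∂Ω` in the trace
sense. The trace operator is the continuous extension to `W^{1,2}(Ω, ℝ²)` of the restriction
of smooth maps to `∂Ω`, with values in `L²(∂Ω)` for the arc length measure. -/
def HasTrace (Ω : Set Plane) (u : Plane → Plane) (G : Plane → Matrix (Fin 2) (Fin 2) ℝ)
    (u₀ : Plane → Plane) : Prop :=
  MemLp u₀ 2 ((Measure.hausdorffMeasure 1 : Measure Plane).restrict (frontier Ω)) ∧
  ∃ ψ : ℕ → Plane → Plane,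
    (∀ n, ContDiff ℝ ∞ (ψ n)) ∧ TendstoSobolev Ω ψ u G ∧
    Tendsto (fun n => eLpNorm (fun x => ψ n x - u₀ x) 2
      ((Measure.hausdorffMeasure 1 : Measure Plane).restrict (frontier Ω))) atTop (𝓝 0)

/-- The density `ρ ∈ C^∞(ℝ)`: zero on `(-∞, 0]`, convex on `[0, s₀]`, and equal to the affine
function `s ↦ γ s + κ` on `[s₀, ∞)`. -/
structure IsDensity (γ s₀ κ : ℝ) (ρ : ℝ → ℝ) : Prop where
  gamma_pos : 0 < γ
  s₀_nonneg : 0 ≤ s₀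
  kappa_ge : -γ * s₀ ≤ κ
  smooth : ContDiff ℝ ∞ ρ
  eq_zero : ∀ s ≤ 0, ρ s = 0
  convexOn : ConvexOn ℝ (Icc 0 s₀) ρ
  eq_affine : ∀ s, s₀ ≤ s → ρ s = γ * s + κ

/-- The cofactor matrix `cof A = (adj A)ᵀ`. -/
def cof (A : Matrix (Fin 2) (Fin 2) ℝ) : Matrix (Fin 2) (Fin 2) ℝ := A.adjugateᵀ

/-- The Frobenius inner product `A · B = ∑ᵢⱼ Aᵢⱼ Bᵢⱼ`. -/
def frobInner (A B : Matrix (Fin 2) (Fin 2) ℝ) : ℝ := ∑ i, ∑ j, A i j * B i j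

/-- `u` is a stationary point of `I(u) = ∫_Ω ½|∇u|² + ρ(det ∇u) dx` in the class `𝒜_{u₀}` of
maps in `W^{1,2}(Ω, ℝ²)` with trace `u₀`: it solves the Euler-Lagrange equation
`∫_Ω (∇u + ρ'(det ∇u) cof ∇u) · ∇φ dx = 0` for all `φ ∈ W₀^{1,2}(Ω, ℝ²)`. -/
def IsStationaryPoint (Ω : Set Plane) (ρ : ℝ → ℝ) (u₀ u : Plane → Plane) : Prop :=
  ∃ G : Plane → Matrix (Fin 2) (Fin 2) ℝ,
    IsSobolevWithGrad Ω u G ∧ HasTrace Ω u G u₀ ∧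
    ∀ (φ : Plane → Plane) (H : Plane → Matrix (Fin 2) (Fin 2) ℝ),
      IsSobolevZeroWithGrad Ω φ H →
      ∫ x in Ω, frobInner (G x + deriv ρ (G x).det • cof (G x)) (H x) = 0

/-- `u ∈ C^{0,α}_loc(Ω, ℝ²)`: some representative of the almost-everywhere class of `u` on `Ω`
is Hölder continuous with exponent `α` on every compact subset of `Ω`. -/
def IsLocallyHolder (Ω : Set Plane) (α : ℝ≥0) (u : Plane → Plane) : Prop :=
  ∃ v : Plane → Plane, u =ᵐ[volume.restrict Ω] v ∧
    ∀ K : Set Plane, IsCompact K → K ⊆ Ω → ∃ C : ℝ≥0, HolderOnWith C α v K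

/-!
The proof is Widman's hole-filling argument in dimension two.

The density satisfies `0 ≤ ρ' ≤ γ` and `ρ'(s) s ≥ 0`, because `ρ'` vanishes on the negative axis,
equals `γ` beyond `s₀` and is nondecreasing in between. As `cof A · A = 2 det A`, the Euler-Lagrange
integrand `A + ρ'(det A) cof A` is coercive, its product with `A` being at least `|A|²`, and it
grows linearly with a constant depending on `γ` only. Testing the equation with `η (u - c)`, where
`η` is a cut-off function equal to `1` on `B(x, 2r)` and supported in `B(x, 3r)`, bounds the
Dirichlet energy on `B(x, r)` by a multiple of the integral of `|∇u|² + r⁻² |u - c|²` over an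
annulus. For a suitable constant `c` the Poincaré inequality on the annulus
(`TendstoSobolev.exists_lintegral_capAnnulus_le`) absorbs the second term. Adding the missing energy
on `B(x, r)` to both sides shows that the energy on `B(x, r)` is at most `θ` times the energy on
`B(x, 3r)`, with `θ < 1` depending on `γ` only (`exists_integral_ball_le_mul_integral_ball`).

Iterating, the energy on discs decays like a power of the radius. By the Poincaré inequality on
discs the mean values of `u` over the discs of radii `3⁻ᵏ` then form a Cauchy sequence with a
geometric rate, and their limit is the Hölder continuous representative
(`TendstoSobolev.isLocallyHolder`).

The trace condition provides smooth maps converging to `u` in `W^{1,2}`. They replace mollification: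
the Poincaré inequality is proved for smooth maps, by integrating along segments of a convex set,
and passes to the limit by Fatou's lemma; cutting them off shows that `η (u - c)` lies in
`W₀^{1,2}`. The annulus, not being convex, is handled as a chain of four overlapping convex caps.
-/

/-! ### The density and the algebra of the Euler-Lagrange integrand -/

/-- The one-sided derivative from the left determines `ρ'`, also at the endpoint `0`. -/
theorem IsDensity.deriv_of_nonpos {γ s₀ κ : ℝ} {ρ : ℝ → ℝ} (h : IsDensity γ s₀ κ ρ) {s : ℝ}
    (hs : s ≤ 0) : deriv ρ s = 0 := by
  have hd : DifferentiableAt ℝ ρ s := h.smooth.differentiable (by simp) s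
  have h1 : HasDerivWithinAt ρ (deriv ρ s) (Iic s) s := hd.hasDerivAt.hasDerivWithinAt
  have h2 : HasDerivWithinAt ρ 0 (Iic s) s :=
    (hasDerivWithinAt_const s (Iic s) (0 : ℝ)).congr
      (fun t ht => h.eq_zero t (le_trans ht hs)) (h.eq_zero s hs)
  exact (uniqueDiffWithinAt_Iic s).eq_deriv _ h1 h2

theorem IsDensity.deriv_of_ge {γ s₀ κ : ℝ} {ρ : ℝ → ℝ} (h : IsDensity γ s₀ κ ρ) {s : ℝ}
    (hs : s₀ ≤ s) : deriv ρ s = γ := by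
  have hd : DifferentiableAt ℝ ρ s := h.smooth.differentiable (by simp) s
  have h1 : HasDerivWithinAt ρ (deriv ρ s) (Ici s) s := hd.hasDerivAt.hasDerivWithinAt
  have h3 : HasDerivWithinAt (fun t => γ * t + κ) γ (Ici s) s := by
    simpa using (((hasDerivAt_id s).const_mul γ).add_const κ).hasDerivWithinAt
  have h2 : HasDerivWithinAt ρ γ (Ici s) s :=
    h3.congr (fun t ht => h.eq_affine t (le_trans hs ht)) (h.eq_affine s hs)
  exact (uniqueDiffWithinAt_Ici s).eq_deriv _ h1 h2

theorem IsDensity.deriv_mem_Icc {γ s₀ κ : ℝ} {ρ : ℝ → ℝ} (h : IsDensity γ s₀ κ ρ) (s : ℝ) :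
    deriv ρ s ∈ Icc 0 γ := by
  have hd : Differentiable ℝ ρ := h.smooth.differentiable (by simp)
  rcases le_or_gt s 0 with hs | hs
  · rw [h.deriv_of_nonpos hs]
    exact ⟨le_rfl, h.gamma_pos.le⟩
  rcases le_or_gt s₀ s with hs' | hs'
  · rw [h.deriv_of_ge hs']
    exact ⟨h.gamma_pos.le, le_rfl⟩
  have m0 : (0 : ℝ) ∈ Icc 0 s₀ := ⟨le_rfl, h.s₀_nonneg⟩
  have ms : s ∈ Icc 0 s₀ := ⟨hs.le, hs'.le⟩
  have m1 : s₀ ∈ Icc 0 s₀ := ⟨h.s₀_nonneg, le_rfl⟩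
  constructor
  · rw [← h.deriv_of_nonpos le_rfl]
    exact (h.convexOn.deriv_le_slope m0 ms hs (hd 0)).trans
      (h.convexOn.slope_le_deriv m0 ms hs (hd s))
  · rw [← h.deriv_of_ge le_rfl]
    exact (h.convexOn.deriv_le_slope ms m1 hs' (hd s)).trans
      (h.convexOn.slope_le_deriv ms m1 hs' (hd s₀))

theorem IsDensity.deriv_mul_self_nonneg {γ s₀ κ : ℝ} {ρ : ℝ → ℝ} (h : IsDensity γ s₀ κ ρ)
    (s : ℝ) : 0 ≤ deriv ρ s * s := by
  rcases le_or_gt s 0 with hs | hs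
  · rw [h.deriv_of_nonpos hs, zero_mul]
  · exact mul_nonneg (h.deriv_mem_Icc s).1 hs.le

theorem frobInner_self_nonneg (A : Matrix (Fin 2) (Fin 2) ℝ) : 0 ≤ frobInner A A :=
  Finset.sum_nonneg fun _ _ => Finset.sum_nonneg fun _ _ => mul_self_nonneg _

/-- The identity `cof A · A = 2 det A` turns `t ↦ t det A ≥ 0` into coercivity of the
Euler-Lagrange integrand. -/
theorem frobInner_le_frobInner_add_smul_cof (A : Matrix (Fin 2) (Fin 2) ℝ) {t : ℝ}
    (ht : 0 ≤ t * A.det) : frobInner A A ≤ frobInner (A + t • cof A) A := by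
  rw [Matrix.det_fin_two] at ht
  simp only [frobInner, cof, Matrix.adjugate_fin_two, Fin.sum_univ_two, Matrix.add_apply,
    Matrix.smul_apply, Matrix.transpose_apply, smul_eq_mul, Matrix.of_apply, Matrix.cons_val',
    Matrix.cons_val_zero, Matrix.cons_val_one, Matrix.cons_val_fin_one]
  nlinarith

/-- Young's inequality for the Euler-Lagrange integrand tested with a rank-one matrix. -/
theorem neg_frobInner_rankOne_le (A : Matrix (Fin 2) (Fin 2) ℝ) {t γ : ℝ} (ht : t ∈ Icc 0 γ)
    (a b : Fin 2 → ℝ) :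
    -((1 + γ ^ 2) * frobInner A A + (a 0 ^ 2 + a 1 ^ 2) * (b 0 ^ 2 + b 1 ^ 2)) ≤
      frobInner (A + t • cof A) (Matrix.of fun i j => a i * b j) := by
  have ht2 : t ^ 2 ≤ γ ^ 2 := pow_le_pow_left₀ ht.1 ht.2 2
  have hA := frobInner_self_nonneg A
  have key : -((1 + t ^ 2) * frobInner A A + (a 0 ^ 2 + a 1 ^ 2) * (b 0 ^ 2 + b 1 ^ 2)) ≤
      frobInner (A + t • cof A) (Matrix.of fun i j => a i * b j) := by
    simp only [frobInner, cof, Matrix.adjugate_fin_two, Fin.sum_univ_two, Matrix.add_apply,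
      Matrix.smul_apply, Matrix.transpose_apply, smul_eq_mul, Matrix.of_apply, Matrix.cons_val',
      Matrix.cons_val_zero, Matrix.cons_val_one, Matrix.cons_val_fin_one]
    have h00 := sq_nonneg (2 * A 0 0 + a 0 * b 0)
    have h01 := sq_nonneg (2 * A 0 1 + a 0 * b 1)
    have h10 := sq_nonneg (2 * A 1 0 + a 1 * b 0)
    have h11 := sq_nonneg (2 * A 1 1 + a 1 * b 1)
    have k00 := sq_nonneg (2 * (t * A 1 1) + a 0 * b 0)
    have k01 := sq_nonneg (2 * (t * A 1 0) - a 0 * b 1)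
    have k10 := sq_nonneg (2 * (t * A 0 1) - a 1 * b 0)
    have k11 := sq_nonneg (2 * (t * A 0 0) + a 1 * b 1)
    have m00 := mul_nonneg (sq_nonneg (a 0)) (sq_nonneg (b 0))
    have m01 := mul_nonneg (sq_nonneg (a 0)) (sq_nonneg (b 1))
    have m10 := mul_nonneg (sq_nonneg (a 1)) (sq_nonneg (b 0))
    have m11 := mul_nonneg (sq_nonneg (a 1)) (sq_nonneg (b 1))
    linarith
  nlinarith

/-- The operator norm is controlled by the Frobenius norm of the Jacobian matrix. -/
theorem norm_fderiv_sq_le_frobInner_jacobianMatrix (ψ : Plane → Plane) (x : Plane) :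
    ‖fderiv ℝ ψ x‖ ^ 2 ≤ frobInner (jacobianMatrix ψ x) (jacobianMatrix ψ x) := by
  set L := fderiv ℝ ψ x with hL
  have hF := frobInner_self_nonneg (jacobianMatrix ψ x)
  have : ‖L‖ ≤ Real.sqrt (frobInner (jacobianMatrix ψ x) (jacobianMatrix ψ x)) := by
    refine L.opNorm_le_bound (Real.sqrt_nonneg _) fun v => ?_
    refine le_of_sq_le_sq ?_ (by positivity)
    rw [mul_pow, Real.sq_sqrt hF, EuclideanSpace.norm_sq_eq, EuclideanSpace.norm_sq_eq]
    have hv : v = v 0 • EuclideanSpace.single 0 1 + v 1 • EuclideanSpace.single 1 1 := by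
      ext i; fin_cases i <;> simp
    have hLv : ∀ i, L v i = v 0 * jacobianMatrix ψ x i 0 + v 1 * jacobianMatrix ψ x i 1 := by
      intro i
      conv_lhs => rw [hv]
      simp [jacobianMatrix, hL]
    simp only [Fin.sum_univ_two, hLv, Real.norm_eq_abs, sq_abs, frobInner]
    generalize jacobianMatrix ψ x = J
    nlinarith [sq_nonneg (v 0 * J 0 1 - v 1 * J 0 0), sq_nonneg (v 0 * J 1 1 - v 1 * J 1 0)]
  calc ‖L‖ ^ 2 ≤ Real.sqrt (frobInner (jacobianMatrix ψ x) (jacobianMatrix ψ x)) ^ 2 := by gcongr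
    _ = _ := Real.sq_sqrt hF

/-! ### The Poincaré inequality on convex sets -/

theorem sq_lintegral_le_measure_mul_lintegral_sq {α : Type*} [MeasurableSpace α] {μ : Measure α}
    {f : α → ℝ≥0∞} (hf : AEMeasurable f μ) :
    (∫⁻ x, f x ∂μ) ^ 2 ≤ μ univ * ∫⁻ x, f x ^ 2 ∂μ := by
  have h := ENNReal.lintegral_mul_le_Lp_mul_Lq μ Real.HolderConjugate.two_two hf
    (aemeasurable_const (b := (1 : ℝ≥0∞)))
  have h2 : ∫⁻ x, f x ∂μ ≤ (∫⁻ x, f x ^ 2 ∂μ) ^ (1 / 2 : ℝ) * (μ univ) ^ (1 / 2 : ℝ) := by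
    simpa using h
  calc (∫⁻ x, f x ∂μ) ^ 2
      ≤ ((∫⁻ x, f x ^ 2 ∂μ) ^ (1 / 2 : ℝ) * (μ univ) ^ (1 / 2 : ℝ)) ^ 2 := by gcongr
    _ = μ univ * ∫⁻ x, f x ^ 2 ∂μ := by
      rw [mul_pow, ← ENNReal.rpow_natCast, ← ENNReal.rpow_natCast, ← ENNReal.rpow_mul,
        ← ENNReal.rpow_mul]
      norm_num [mul_comm]

theorem enorm_sub_sq_le_lintegral_segment {E F : Type*} [NormedAddCommGroup E] [NormedSpace ℝ E]
    [NormedAddCommGroup F] [NormedSpace ℝ F] {ψ : E → F} (hψ : ContDiff ℝ 1 ψ) (x y : E) :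
    ‖ψ y - ψ x‖ₑ ^ 2 ≤
      ‖y - x‖ₑ ^ 2 * ∫⁻ t in Icc (0 : ℝ) 1, ‖fderiv ℝ ψ (x + t • (y - x))‖ₑ ^ 2 := by
  have hc : Continuous fun t : ℝ => fderiv ℝ ψ (x + t • (y - x)) :=
    (hψ.continuous_fderiv (by simp)).comp (by fun_prop)
  have hf : ContDiff ℝ 1 fun t : ℝ => ψ (x + t • (y - x)) := by fun_prop
  have h1 := enorm_sub_le_lintegral_deriv_of_contDiffOn_Icc (a := (0 : ℝ)) (b := 1)
    (hf.contDiffOn) zero_le_one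
  simp only [one_smul, zero_smul, add_zero, add_sub_cancel] at h1
  have h2 : ∀ t : ℝ, ‖deriv (fun t : ℝ => ψ (x + t • (y - x))) t‖ₑ ≤
      ‖y - x‖ₑ * ‖fderiv ℝ ψ (x + t • (y - x))‖ₑ := by
    intro t
    have hd : HasDerivAt (fun t : ℝ => x + t • (y - x)) (y - x) t := by
      simpa using ((hasDerivAt_id t).smul_const (y - x)).const_add x
    have := ((hψ.differentiable (by simp) (x + t • (y - x))).hasFDerivAt.comp_hasDerivAt t hd)
    rw [show deriv (fun t : ℝ => ψ (x + t • (y - x))) t = _ from this.deriv, mul_comm]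
    exact ContinuousLinearMap.le_opENorm _ _
  calc ‖ψ y - ψ x‖ₑ ^ 2
      ≤ (∫⁻ t in Icc (0 : ℝ) 1, ‖y - x‖ₑ * ‖fderiv ℝ ψ (x + t • (y - x))‖ₑ) ^ 2 := by
        gcongr
        exact h1.trans (lintegral_mono h2)
    _ = ‖y - x‖ₑ ^ 2 * (∫⁻ t in Icc (0 : ℝ) 1, ‖fderiv ℝ ψ (x + t • (y - x))‖ₑ) ^ 2 := by
        rw [lintegral_const_mul _ hc.enorm.measurable, mul_pow]
    _ ≤ _ := by
        gcongr
        refine (sq_lintegral_le_measure_mul_lintegral_sq hc.enorm.aemeasurable).trans_eq ?_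
        simp

/-- Contraction towards `x` by a factor `t ≥ 1/2` maps a convex set into itself and distorts
planar measure by at most `4`. -/
theorem setLIntegral_comp_contraction_le {S : Set Plane} (hS : Convex ℝ S)
    (hm : MeasurableSet S) {h : Plane → ℝ≥0∞} (hh : Measurable h) {x : Plane} (hx : x ∈ S)
    {t : ℝ} (ht : t ∈ Icc (1 / 2 : ℝ) 1) :
    ∫⁻ y in S, h (x + t • (y - x)) ≤ 4 * ∫⁻ y in S, h y := by
  have ht0 : 0 < t := by linarith [ht.1]
  have hmS : Measurable (S.indicator h) := hh.indicator hm
  calc ∫⁻ y in S, h (x + t • (y - x))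
      ≤ ∫⁻ y, S.indicator h ((x - t • x) + t • y) := by
        rw [← lintegral_indicator hm]
        refine lintegral_mono fun y => ?_
        by_cases hy : y ∈ S
        · have e : x + t • (y - x) = (x - t • x) + t • y := by rw [smul_sub]; abel
          have hmem : (x - t • x) + t • y ∈ S := by
            rw [← e]
            exact hS.add_smul_sub_mem hx hy ⟨ht0.le, ht.2⟩
          simp only [indicator_of_mem hy, indicator_of_mem hmem, e, le_refl]
        · simp [indicator_of_notMem hy]
    _ = ∫⁻ z, S.indicator h ((x - t • x) + z) ∂(Measure.map (t • ·) (volume : Measure Plane)) := by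
        rw [lintegral_map (by fun_prop) (measurable_const_smul t)]
    _ = ENNReal.ofReal |(t ^ 2)⁻¹| * ∫⁻ z, S.indicator h z := by
        rw [Measure.map_addHaar_smul _ ht0.ne', lintegral_smul_measure,
          lintegral_add_left_eq_self (S.indicator h) (x - t • x)]
        simp
    _ ≤ 4 * ∫⁻ y in S, h y := by
        rw [lintegral_indicator hm]
        gcongr
        rw [abs_of_pos (by positivity), show (4 : ℝ≥0∞) = ENNReal.ofReal 4 by simp]
        apply ENNReal.ofReal_le_ofReal
        rw [inv_le_comm₀ (by positivity) (by positivity)]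
        nlinarith [ht.1]

theorem lintegral_lintegral_lintegral_rotate {α β : Type*} [MeasurableSpace α]
    [MeasurableSpace β] {μ : Measure α} {ν : Measure β} [SFinite μ] [SFinite ν]
    {f : α → α → β → ℝ≥0∞} (hf : Measurable fun p : (α × α) × β => f p.1.1 p.1.2 p.2) :
    ∫⁻ x, ∫⁻ y, ∫⁻ t, f x y t ∂ν ∂μ ∂μ = ∫⁻ t, ∫⁻ x, ∫⁻ y, f x y t ∂μ ∂μ ∂ν := by
  have h1 : ∀ x, ∫⁻ y, ∫⁻ t, f x y t ∂ν ∂μ = ∫⁻ t, ∫⁻ y, f x y t ∂μ ∂ν := fun x =>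
    lintegral_lintegral_swap (hf.comp
      ((measurable_const.prodMk measurable_fst).prodMk measurable_snd)).aemeasurable
  simp_rw [h1]
  have h2 : Measurable fun p : (α × β) × α => f p.1.1 p.2 p.1.2 :=
    hf.comp (((measurable_fst.comp measurable_fst).prodMk measurable_snd).prodMk
      (measurable_snd.comp measurable_fst))
  exact lintegral_lintegral_swap h2.lintegral_prod_right'.aemeasurable

theorem lintegral_lintegral_segment_le {S : Set Plane} (hS : Convex ℝ S) (hm : MeasurableSet S)
    {h : Plane → ℝ≥0∞} (hh : Measurable h) :
    ∫⁻ x in S, ∫⁻ y in S, ∫⁻ t in Icc (0 : ℝ) 1, h (x + t • (y - x)) ≤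
      4 * volume S * ∫⁻ z in S, h z := by
  have hm1 : Measurable fun p : (Plane × Plane) × ℝ => h (p.1.1 + p.2 • (p.1.2 - p.1.1)) :=
    hh.comp (by fun_prop)
  have hseg : ∀ t ∈ Icc (0 : ℝ) 1,
      ∫⁻ x in S, ∫⁻ y in S, h (x + t • (y - x)) ≤ 4 * volume S * ∫⁻ z in S, h z := by
    intro t ht
    have hconst : ∫⁻ x in S, 4 * ∫⁻ z in S, h z = 4 * volume S * ∫⁻ z in S, h z := by
      rw [setLIntegral_const]; ring
    rw [← hconst]
    -- Contract towards the endpoint that is at least half a segment away.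
    rcases le_total (1 / 2) t with h2 | h2
    · exact setLIntegral_mono' hm fun x hx =>
        setLIntegral_comp_contraction_le hS hm hh hx ⟨h2, ht.2⟩
    · have hsw : ∫⁻ x in S, ∫⁻ y in S, h (x + t • (y - x)) =
          ∫⁻ y in S, ∫⁻ x in S, h (x + t • (y - x)) :=
        lintegral_lintegral_swap (f := fun x y : Plane => h (x + t • (y - x)))
          (hm1.comp (measurable_id.prodMk measurable_const)).aemeasurable
      have hrev : ∀ x y : Plane, x + t • (y - x) = y + (1 - t) • (x - y) := fun x y => by
        rw [sub_smul, one_smul, smul_sub, smul_sub]; abel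
      rw [hsw]
      simp_rw [hrev]
      exact setLIntegral_mono' hm fun x hx =>
        setLIntegral_comp_contraction_le hS hm hh hx ⟨by linarith, by linarith [ht.1]⟩
  rw [lintegral_lintegral_lintegral_rotate hm1]
  refine (setLIntegral_mono' measurableSet_Icc hseg).trans_eq ?_
  simp

/-- Poincaré inequality for smooth maps on a convex set, as a bound on the double integral of the
squared differences. -/
theorem lintegral_lintegral_enorm_sub_sq_le_of_contDiff {F : Type*} [NormedAddCommGroup F]
    [NormedSpace ℝ F] {ψ : Plane → F} (hψ : ContDiff ℝ 1 ψ)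
    {S : Set Plane} (hS : Convex ℝ S) (hm : MeasurableSet S) {d : ℝ≥0∞} (hdt : d ≠ ⊤)
    (hd : ∀ x ∈ S, ∀ y ∈ S, ‖x - y‖ₑ ≤ d) :
    ∫⁻ x in S, ∫⁻ y in S, ‖ψ x - ψ y‖ₑ ^ 2 ≤
      4 * d ^ 2 * volume S * ∫⁻ z in S, ‖fderiv ℝ ψ z‖ₑ ^ 2 := by
  have hh : Measurable fun z => ‖fderiv ℝ ψ z‖ₑ ^ 2 :=
    (hψ.continuous_fderiv (by simp)).enorm.measurable.pow_const 2
  have hdt2 : d ^ 2 ≠ ⊤ := ENNReal.pow_ne_top hdt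
  calc ∫⁻ x in S, ∫⁻ y in S, ‖ψ x - ψ y‖ₑ ^ 2
      ≤ ∫⁻ x in S, ∫⁻ y in S,
          d ^ 2 * ∫⁻ t in Icc (0 : ℝ) 1, ‖fderiv ℝ ψ (x + t • (y - x))‖ₑ ^ 2 := by
        refine setLIntegral_mono' hm fun x hx => setLIntegral_mono' hm fun y hy => ?_
        rw [enorm_sub_rev]
        refine (enorm_sub_sq_le_lintegral_segment hψ x y).trans ?_
        gcongr
        exact hd y hy x hx
    _ = d ^ 2 * ∫⁻ x in S, ∫⁻ y in S, ∫⁻ t in Icc (0 : ℝ) 1,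
          ‖fderiv ℝ ψ (x + t • (y - x))‖ₑ ^ 2 := by
        simp_rw [lintegral_const_mul' _ _ hdt2]
    _ ≤ d ^ 2 * (4 * volume S * ∫⁻ z in S, ‖fderiv ℝ ψ z‖ₑ ^ 2) := by
        gcongr
        exact lintegral_lintegral_segment_le hS hm hh
    _ = _ := by ring

/-! ### The Poincaré inequality for limits of smooth maps -/

theorem eLpNorm_two_sq {α F : Type*} [MeasurableSpace α] [NormedAddCommGroup F] {μ : Measure α}
    (f : α → F) : eLpNorm f 2 μ ^ 2 = ∫⁻ x, ‖f x‖ₑ ^ 2 ∂μ := by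
  have h := eLpNorm_nnreal_pow_eq_lintegral (f := f) (μ := μ) (p := 2) (by norm_num)
  simpa using h

theorem ofReal_frobInner_self (A : Matrix (Fin 2) (Fin 2) ℝ) :
    ENNReal.ofReal (frobInner A A) = ∑ i, ∑ j, ‖A i j‖ₑ ^ 2 := by
  have h0 : ∀ i j, 0 ≤ A i j * A i j := fun _ _ => mul_self_nonneg _
  have h1 : ∀ i j, ‖A i j‖ₑ ^ 2 = ENNReal.ofReal (A i j * A i j) := fun i j => by
    rw [← Real.enorm_of_nonneg (h0 i j), enorm_mul, sq]
  simp_rw [h1, frobInner, Fin.sum_univ_two]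
  rw [ENNReal.ofReal_add (add_nonneg (h0 _ _) (h0 _ _)) (add_nonneg (h0 _ _) (h0 _ _)),
    ENNReal.ofReal_add (h0 _ _) (h0 _ _), ENNReal.ofReal_add (h0 _ _) (h0 _ _)]

theorem lintegral_ofReal_frobInner_self {μ : Measure Plane}
    {G : Plane → Matrix (Fin 2) (Fin 2) ℝ}
    (hG : ∀ i j, AEStronglyMeasurable (fun x => G x i j) μ) :
    ∫⁻ x, ENNReal.ofReal (frobInner (G x) (G x)) ∂μ =
      ∑ i, ∑ j, eLpNorm (fun x => G x i j) 2 μ ^ 2 := by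
  simp_rw [ofReal_frobInner_self, eLpNorm_two_sq]
  rw [lintegral_finsetSum']
  · refine Finset.sum_congr rfl fun i _ => ?_
    rw [lintegral_finsetSum']
    exact fun j _ => (hG i j).enorm.pow_const 2
  · exact fun i _ => Finset.aemeasurable_fun_sum _ fun j _ => (hG i j).enorm.pow_const 2

theorem continuous_jacobianMatrix {ψ : Plane → Plane} (hψ : ContDiff ℝ ∞ ψ) (i j : Fin 2) :
    Continuous fun x => jacobianMatrix ψ x i j := by
  have h : Continuous fun x => fderiv ℝ ψ x (EuclideanSpace.single j 1) :=
    (hψ.continuous_fderiv (by simp)).clm_apply continuous_const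
  exact (EuclideanSpace.proj (𝕜 := ℝ) i).continuous.comp h

/-- Passing to the limit needs only lower semicontinuity of the double integral and an upper bound
for the energies of the approximants. -/
theorem TendstoSobolev.lintegral_lintegral_enorm_sub_sq_le {Ω : Set Plane} {u : Plane → Plane}
    {G : Plane → Matrix (Fin 2) (Fin 2) ℝ} {ψ : ℕ → Plane → Plane}
    (h : TendstoSobolev Ω ψ u G) (hu : IsSobolevWithGrad Ω u G) (hψ : ∀ n, ContDiff ℝ ∞ (ψ n))
    {S : Set Plane} (hSΩ : S ⊆ Ω) (hS : Convex ℝ S) (hm : MeasurableSet S)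
    (hfin : volume S ≠ ⊤) {d : ℝ≥0∞} (hdt : d ≠ ⊤) (hd : ∀ x ∈ S, ∀ y ∈ S, ‖x - y‖ₑ ≤ d) :
    ∫⁻ x in S, ∫⁻ y in S, ‖u x - u y‖ₑ ^ 2 ≤
      4 * d ^ 2 * volume S * ∫⁻ z in S, ENNReal.ofReal (frobInner (G z) (G z)) := by
  have hr : (volume.restrict S : Measure Plane) ≤ volume.restrict Ω :=
    Measure.restrict_mono_set _ hSΩ
  have huS : MemLp u 2 (volume.restrict S) := hu.memLp.mono_measure hr
  have hGS : ∀ i j, MemLp (fun x => G x i j) 2 (volume.restrict S) := fun i j =>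
    (hu.memLp_grad i j).mono_measure hr
  have t1 : Tendsto (fun n => eLpNorm (ψ n - u) 2 (volume.restrict S)) atTop (𝓝 0) :=
    tendsto_of_tendsto_of_tendsto_of_le_of_le tendsto_const_nhds h.1 (fun _ => zero_le)
      fun n => eLpNorm_mono_measure _ hr
  obtain ⟨ns, hns, hae⟩ := (tendstoInMeasure_of_tendsto_eLpNorm two_ne_zero
    (fun n => (hψ n).continuous.aestronglyMeasurable) huS.1 t1).exists_seq_tendsto_ae
  have hfatou : ∫⁻ x in S, ∫⁻ y in S, ‖u x - u y‖ₑ ^ 2 ≤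
      liminf (fun n => ∫⁻ x in S, ∫⁻ y in S, ‖ψ (ns n) x - ψ (ns n) y‖ₑ ^ 2) atTop := by
    refine le_trans ?_ (lintegral_liminf_le fun n => ?_)
    · refine lintegral_mono_ae ?_
      filter_upwards [hae] with x hx
      refine le_trans ?_ (lintegral_liminf_le fun n => ?_)
      · refine lintegral_mono_ae ?_
        filter_upwards [hae] with y hy
        exact (ENNReal.Tendsto.pow (hx.sub hy).enorm).liminf_eq.ge
      · exact ((continuous_const.sub (hψ _).continuous).enorm.measurable).pow_const 2
    · have : Continuous fun p : Plane × Plane => ψ (ns n) p.1 - ψ (ns n) p.2 :=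
        ((hψ _).continuous.comp continuous_fst).sub ((hψ _).continuous.comp continuous_snd)
      exact (this.enorm.measurable.pow_const 2).lintegral_prod_right'
  have hK : 4 * d ^ 2 * volume S ≠ ⊤ :=
    ENNReal.mul_ne_top (ENNReal.mul_ne_top (by simp) (ENNReal.pow_ne_top hdt)) hfin
  have hbound : ∀ n, ∫⁻ x in S, ∫⁻ y in S, ‖ψ n x - ψ n y‖ₑ ^ 2 ≤
      4 * d ^ 2 * volume S * ∑ i, ∑ j,
        (eLpNorm (fun x => jacobianMatrix (ψ n) x i j - G x i j) 2 (volume.restrict Ω) +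
          eLpNorm (fun x => G x i j) 2 (volume.restrict S)) ^ 2 := by
    intro n
    refine (lintegral_lintegral_enorm_sub_sq_le_of_contDiff ((hψ n).of_le (by simp)) hS hm hdt
      hd).trans ?_
    gcongr
    calc ∫⁻ z in S, ‖fderiv ℝ (ψ n) z‖ₑ ^ 2
        ≤ ∫⁻ z in S, ENNReal.ofReal (frobInner (jacobianMatrix (ψ n) z)
            (jacobianMatrix (ψ n) z)) := by
          refine lintegral_mono fun z => ?_
          rw [← ofReal_norm, ← ENNReal.ofReal_pow (norm_nonneg _)]
          exact ENNReal.ofReal_le_ofReal (norm_fderiv_sq_le_frobInner_jacobianMatrix _ _)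
      _ = ∑ i, ∑ j, eLpNorm (fun x => jacobianMatrix (ψ n) x i j) 2 (volume.restrict S) ^ 2 :=
          lintegral_ofReal_frobInner_self fun i j =>
            (continuous_jacobianMatrix (hψ n) i j).aestronglyMeasurable
      _ ≤ _ := by
          gcongr with i _ j _
          have hs := eLpNorm_add_le (p := 2) (μ := volume.restrict S)
            (f := fun x => jacobianMatrix (ψ n) x i j - G x i j) (g := fun x => G x i j)
            ((continuous_jacobianMatrix (hψ n) i j).aestronglyMeasurable.sub (hGS i j).1)
            (hGS i j).1 (by norm_num)
          have he : ((fun x => jacobianMatrix (ψ n) x i j - G x i j) + fun x => G x i j) =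
              fun x => jacobianMatrix (ψ n) x i j := by ext x; simp
          rw [he] at hs
          refine hs.trans ?_
          gcongr
  have hlim : Tendsto (fun n => 4 * d ^ 2 * volume S * ∑ i, ∑ j,
        (eLpNorm (fun x => jacobianMatrix (ψ n) x i j - G x i j) 2 (volume.restrict Ω) +
          eLpNorm (fun x => G x i j) 2 (volume.restrict S)) ^ 2) atTop
      (𝓝 (4 * d ^ 2 * volume S * ∑ i, ∑ j,
        (eLpNorm (fun x => G x i j) 2 (volume.restrict S)) ^ 2)) := by
    refine ENNReal.Tendsto.const_mul ?_ (Or.inr hK)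
    refine tendsto_finsetSum _ fun i _ => tendsto_finsetSum _ fun j _ => ?_
    have := ((h.2 i j).add_const (eLpNorm (fun x => G x i j) 2 (volume.restrict S)))
    rw [zero_add] at this
    exact ENNReal.Tendsto.pow this
  rw [lintegral_ofReal_frobInner_self fun i j => (hGS i j).1,
    ← (hlim.comp hns.tendsto_atTop).liminf_eq]
  exact hfatou.trans (liminf_le_liminf (Eventually.of_forall fun n => hbound (ns n)))

/-- The constant is a value `u y` at a point `y` that is at most average for the double
integral. -/
theorem TendstoSobolev.exists_lintegral_enorm_sub_const_sq_le {Ω : Set Plane}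
    {u : Plane → Plane} {G : Plane → Matrix (Fin 2) (Fin 2) ℝ} {ψ : ℕ → Plane → Plane}
    (h : TendstoSobolev Ω ψ u G) (hu : IsSobolevWithGrad Ω u G) (hψ : ∀ n, ContDiff ℝ ∞ (ψ n))
    {S : Set Plane} (hSΩ : S ⊆ Ω) (hS : Convex ℝ S) (hm : MeasurableSet S)
    (h0 : volume S ≠ 0)
    (hfin : volume S ≠ ⊤) {d : ℝ≥0∞} (hdt : d ≠ ⊤) (hd : ∀ x ∈ S, ∀ y ∈ S, ‖x - y‖ₑ ≤ d) :
    ∃ c : Plane, ∫⁻ x in S, ‖u x - c‖ₑ ^ 2 ≤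
      4 * d ^ 2 * ∫⁻ z in S, ENNReal.ofReal (frobInner (G z) (G z)) := by
  have huS : AEStronglyMeasurable u (volume.restrict S) :=
    (hu.memLp.mono_measure (Measure.restrict_mono_set _ hSΩ)).1
  have hmeas : AEMeasurable (fun x => ∫⁻ y in S, ‖u x - u y‖ₑ ^ 2) (volume.restrict S) := by
    have : AEStronglyMeasurable (fun p : Plane × Plane => u p.1 - u p.2)
        ((volume.restrict S).prod (volume.restrict S)) := huS.comp_fst.sub huS.comp_snd
    exact (this.enorm.pow_const 2).lintegral_prod_right'
  obtain ⟨y, -, hy⟩ := exists_le_setLAverage h0 hfin hmeas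
  refine ⟨u y, ?_⟩
  simp_rw [enorm_sub_rev (u _) (u y)]
  refine hy.trans ?_
  rw [setLAverage_eq, ENNReal.div_le_iff h0 hfin]
  refine (h.lintegral_lintegral_enorm_sub_sq_le hu hψ hSΩ hS hm hfin hdt hd).trans_eq ?_
  ring

theorem enorm_add_sq_le {F : Type*} [NormedAddCommGroup F] (a b : F) :
    ‖a + b‖ₑ ^ 2 ≤ 2 * ‖a‖ₑ ^ 2 + 2 * ‖b‖ₑ ^ 2 := by
  have h : ‖a + b‖₊ ^ 2 ≤ 2 * ‖a‖₊ ^ 2 + 2 * ‖b‖₊ ^ 2 := by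
    rw [← NNReal.coe_le_coe]
    push_cast
    nlinarith [norm_add_le a b, norm_nonneg (a + b), sq_nonneg (‖a‖ - ‖b‖), norm_nonneg a,
      norm_nonneg b]
  simp only [enorm]
  exact_mod_cast h

/-- Closeness to constants in `L²` propagates from two sets to their union as soon as their
overlap carries a fixed fraction of the measure. -/
theorem lintegral_union_enorm_sub_const_sq_le {F : Type*} [NormedAddCommGroup F]
    {u : Plane → F} {S T : Set Plane} {a b : F} {M N : ℝ≥0∞}
    (huS : AEStronglyMeasurable u (volume.restrict S))
    (huT : AEStronglyMeasurable u (volume.restrict T))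
    (ha : ∫⁻ x in S, ‖u x - a‖ₑ ^ 2 ≤ M) (hb : ∫⁻ x in T, ‖u x - b‖ₑ ^ 2 ≤ M)
    (hN : volume T ≤ N * volume (S ∩ T)) :
    ∫⁻ x in S ∪ T, ‖u x - a‖ₑ ^ 2 ≤ (3 + 8 * N) * M := by
  have hma : AEMeasurable (fun x => ‖u x - a‖ₑ ^ 2) (volume.restrict (S ∩ T)) :=
    ((huS.mono_set inter_subset_left).sub aestronglyMeasurable_const).enorm.pow_const 2
  have hmb : AEMeasurable (fun x => ‖u x - b‖ₑ ^ 2) (volume.restrict T) :=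
    (huT.sub aestronglyMeasurable_const).enorm.pow_const 2
  have hab : ‖b - a‖ₑ ^ 2 * volume (S ∩ T) ≤ 4 * M := by
    calc ‖b - a‖ₑ ^ 2 * volume (S ∩ T) = ∫⁻ x in S ∩ T, ‖b - a‖ₑ ^ 2 := by
          rw [setLIntegral_const]
      _ ≤ ∫⁻ x in S ∩ T, (2 * ‖u x - a‖ₑ ^ 2 + 2 * ‖u x - b‖ₑ ^ 2) := by
          refine lintegral_mono fun x => ?_
          have := enorm_add_sq_le (u x - a) (b - u x)
          rwa [sub_add_sub_comm, add_comm (u x) b, add_sub_add_right_eq_sub,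
            enorm_sub_rev b (u x)] at this
      _ = 2 * (∫⁻ x in S ∩ T, ‖u x - a‖ₑ ^ 2) + 2 * ∫⁻ x in S ∩ T, ‖u x - b‖ₑ ^ 2 := by
          rw [lintegral_add_left' (hma.const_mul 2), lintegral_const_mul' _ _ (by simp),
            lintegral_const_mul' _ _ (by simp)]
      _ ≤ 2 * M + 2 * M := by
          gcongr
          · exact (lintegral_mono_set inter_subset_left).trans ha
          · exact (lintegral_mono_set inter_subset_right).trans hb
      _ = 4 * M := by ring
  have hTa : ∫⁻ x in T, ‖u x - a‖ₑ ^ 2 ≤ 2 * M + 8 * N * M := by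
    calc ∫⁻ x in T, ‖u x - a‖ₑ ^ 2
        ≤ ∫⁻ x in T, (2 * ‖u x - b‖ₑ ^ 2 + 2 * ‖b - a‖ₑ ^ 2) := by
          refine lintegral_mono fun x => ?_
          have := enorm_add_sq_le (u x - b) (b - a)
          rwa [sub_add_sub_cancel] at this
      _ = 2 * (∫⁻ x in T, ‖u x - b‖ₑ ^ 2) + 2 * ‖b - a‖ₑ ^ 2 * volume T := by
          rw [lintegral_add_left' (hmb.const_mul 2), lintegral_const_mul' _ _ (by simp),
            setLIntegral_const]
      _ ≤ 2 * M + 2 * ‖b - a‖ₑ ^ 2 * (N * volume (S ∩ T)) := by gcongr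
      _ = 2 * M + 2 * N * (‖b - a‖ₑ ^ 2 * volume (S ∩ T)) := by ring
      _ ≤ 2 * M + 2 * N * (4 * M) := by gcongr
      _ = _ := by ring
  calc ∫⁻ x in S ∪ T, ‖u x - a‖ₑ ^ 2 ≤ M + (2 * M + 8 * N * M) :=
        (lintegral_union_le _ _ _).trans (add_le_add ha hTa)
    _ = _ := by ring

/-! ### The Poincaré inequality on a planar annulus -/

/-- The cap cut off from the disc `B(x₀, 3r)` by the line at distance `r` from the centre, on the
side of the direction `e`. -/
def discCap (x₀ : Plane) (r : ℝ) (e : Plane) : Set Plane :=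
  Metric.ball x₀ (3 * r) ∩ {x | r < inner ℝ e (x - x₀)}

/-- The union of the four caps in the coordinate directions: a substitute for the annulus
`B(x₀, 3r) \ B(x₀, r)` that is a chain of overlapping convex sets. -/
def capAnnulus (x₀ : Plane) (r : ℝ) : Set Plane :=
  ((discCap x₀ r (EuclideanSpace.single 0 1) ∪ discCap x₀ r (EuclideanSpace.single 1 1)) ∪
    discCap x₀ r (-EuclideanSpace.single 0 1)) ∪ discCap x₀ r (-EuclideanSpace.single 1 1)

theorem isOpen_discCap (x₀ : Plane) (r : ℝ) (e : Plane) : IsOpen (discCap x₀ r e) :=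
  Metric.isOpen_ball.inter (isOpen_lt continuous_const (by fun_prop))

theorem convex_discCap (x₀ : Plane) (r : ℝ) (e : Plane) : Convex ℝ (discCap x₀ r e) := by
  refine (convex_ball _ _).inter ?_
  have h : {x : Plane | r < inner ℝ e (x - x₀)} =
      {x : Plane | r + inner ℝ e x₀ < (innerSL ℝ e) x} := by
    ext x
    simp [inner_sub_right, lt_sub_iff_add_lt]
  rw [h]
  exact convex_halfSpace_gt (innerSL ℝ e).toLinearMap.isLinear _

theorem isOpen_capAnnulus (x₀ : Plane) (r : ℝ) : IsOpen (capAnnulus x₀ r) :=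
  (((isOpen_discCap _ _ _).union (isOpen_discCap _ _ _)).union (isOpen_discCap _ _ _)).union
    (isOpen_discCap _ _ _)

theorem capAnnulus_subset_ball (x₀ : Plane) (r : ℝ) :
    capAnnulus x₀ r ⊆ Metric.ball x₀ (3 * r) :=
  union_subset (union_subset (union_subset inter_subset_left inter_subset_left)
    inter_subset_left) inter_subset_left

theorem disjoint_ball_capAnnulus (x₀ : Plane) (r : ℝ) :
    Disjoint (Metric.ball x₀ r) (capAnnulus x₀ r) := by
  rw [Set.disjoint_left]
  intro x hx hA
  have key : ∀ e : Plane, ‖e‖ = 1 → x ∉ discCap x₀ r e := by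
    rintro e he ⟨-, h⟩
    have h1 := real_inner_le_norm e (x - x₀)
    rw [he, one_mul, ← dist_eq_norm] at h1
    exact absurd (lt_of_lt_of_le h h1) (not_lt.2 (Metric.mem_ball.1 hx).le)
  rcases hA with ((h | h) | h) | h
  · exact key _ (by simp) h
  · exact key _ (by simp) h
  · exact key _ (by simp) h
  · exact key _ (by simp) h

theorem ball_diff_ball_subset_capAnnulus (x₀ : Plane) {r : ℝ} (hr : 0 < r) :
    Metric.ball x₀ (3 * r) \ Metric.ball x₀ (2 * r) ⊆ capAnnulus x₀ r := by
  rintro x ⟨h3, h2⟩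
  by_contra hA
  simp only [capAnnulus, discCap, mem_union, mem_inter_iff, h3, true_and, mem_ofPred_eq,
    inner_neg_left, EuclideanSpace.inner_single_left, map_one, one_mul, not_or, not_lt] at hA
  obtain ⟨⟨⟨ha, hb⟩, hc⟩, hd⟩ := hA
  rw [Metric.mem_ball, not_lt, dist_eq_norm] at h2
  have h4 : (2 * r) ^ 2 ≤ ‖x - x₀‖ ^ 2 := by gcongr
  rw [EuclideanSpace.norm_sq_eq, Fin.sum_univ_two, Real.norm_eq_abs, Real.norm_eq_abs, sq_abs,
    sq_abs] at h4
  nlinarith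

/-- Caps in orthogonal directions share a disc of radius `r / 2`. -/
theorem ball_subset_discCap_inter {x₀ : Plane} {r : ℝ} (hr : 0 < r) {e e' : Plane}
    (he : ‖e‖ = 1) (he' : ‖e'‖ = 1) (hee : inner ℝ e e' = 0) :
    Metric.ball (x₀ + (3 / 2 * r) • (e + e')) (r / 2) ⊆ discCap x₀ r e ∩ discCap x₀ r e' := by
  intro x hx
  set z := x - (x₀ + (3 / 2 * r) • (e + e')) with hz
  have hzn : ‖z‖ < r / 2 := by rwa [Metric.mem_ball, dist_eq_norm] at hx
  have hxz : x - x₀ = z + (3 / 2 * r) • (e + e') := by rw [hz]; abel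
  have hn : ‖e + e'‖ ≤ 3 / 2 := by
    have : ‖e + e'‖ ^ 2 ≤ (3 / 2) ^ 2 := by
      rw [norm_add_sq_real, he, he', hee]; norm_num
    exact le_of_sq_le_sq this (by norm_num)
  have hball : x ∈ Metric.ball x₀ (3 * r) := by
    rw [Metric.mem_ball, dist_eq_norm, hxz]
    refine (norm_add_le _ _).trans_lt ?_
    rw [norm_smul, Real.norm_of_nonneg (by positivity)]
    nlinarith
  have h1 : inner ℝ e (x - x₀) = inner ℝ e z + 3 / 2 * r := by
    rw [hxz, inner_add_right, inner_smul_right, inner_add_right, hee, real_inner_self_eq_norm_sq,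
      he]; ring
  have h2 : inner ℝ e' (x - x₀) = inner ℝ e' z + 3 / 2 * r := by
    rw [hxz, inner_add_right, inner_smul_right, inner_add_right, real_inner_comm e e', hee,
      real_inner_self_eq_norm_sq, he']; ring
  have h3 := abs_real_inner_le_norm e z
  have h4 := abs_real_inner_le_norm e' z
  rw [he, one_mul] at h3
  rw [he', one_mul] at h4
  refine ⟨⟨hball, ?_⟩, hball, ?_⟩
  · rw [mem_ofPred_eq, h1]; linarith [(abs_le.1 h3).1]
  · rw [mem_ofPred_eq, h2]; linarith [(abs_le.1 h4).1]

/-- The factor `36` is the ratio of the areas of the discs of radii `3r` and `r / 2`. -/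
theorem volume_discCap_le_mul_volume_inter {x₀ : Plane} {r : ℝ} (hr : 0 < r) {e e' : Plane}
    (he : ‖e‖ = 1) (he' : ‖e'‖ = 1) (hee : inner ℝ e e' = 0) :
    volume (discCap x₀ r e') ≤ 36 * volume (discCap x₀ r e ∩ discCap x₀ r e') := by
  calc volume (discCap x₀ r e') ≤ volume (Metric.ball x₀ (3 * r)) :=
        measure_mono inter_subset_left
    _ = 36 * volume (Metric.ball (x₀ + (3 / 2 * r) • (e + e')) (r / 2)) := by
        have h6 : ENNReal.ofReal (3 * r) ^ 2 = 36 * ENNReal.ofReal (r / 2) ^ 2 := by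
          rw [show 3 * r = 6 * (r / 2) by ring, ENNReal.ofReal_mul (by norm_num), mul_pow]
          norm_num
        rw [EuclideanSpace.volume_ball_fin_two, EuclideanSpace.volume_ball_fin_two, h6, mul_assoc]
    _ ≤ _ := by
        gcongr
        exact ball_subset_discCap_inter hr he he' hee

/-- Poincaré inequality on the annulus, with a constant that scales like `r²`. Each of the three
caps joined to the first one costs a factor `291 = 3 + 8 * 36`. -/
theorem TendstoSobolev.exists_lintegral_capAnnulus_le {Ω : Set Plane}
    {u : Plane → Plane} {G : Plane → Matrix (Fin 2) (Fin 2) ℝ} {ψ : ℕ → Plane → Plane}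
    (h : TendstoSobolev Ω ψ u G) (hu : IsSobolevWithGrad Ω u G) (hψ : ∀ n, ContDiff ℝ ∞ (ψ n))
    {x₀ : Plane} {r : ℝ} (hr : 0 < r) (hΩ : Metric.ball x₀ (3 * r) ⊆ Ω) :
    ∃ c : Plane, ∫⁻ x in capAnnulus x₀ r, ‖u x - c‖ₑ ^ 2 ≤
      291 ^ 3 * (4 * ENNReal.ofReal (6 * r) ^ 2) *
        ∫⁻ x in capAnnulus x₀ r, ENNReal.ofReal (frobInner (G x) (G x)) := by
  set M : ℝ≥0∞ := (4 * ENNReal.ofReal (6 * r) ^ 2) *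
        ∫⁻ x in capAnnulus x₀ r, ENNReal.ofReal (frobInner (G x) (G x)) with hM
  have hmeas : ∀ S ⊆ Ω, AEStronglyMeasurable u (volume.restrict S) := fun S hS =>
    (hu.memLp.mono_measure (Measure.restrict_mono_set _ hS)).1
  have hsub : ∀ e, discCap x₀ r e ⊆ Ω := fun e => inter_subset_left.trans hΩ
  have cap : ∀ e e', ‖e‖ = 1 → ‖e'‖ = 1 → inner ℝ e e' = 0 →
      discCap x₀ r e ⊆ capAnnulus x₀ r →
      ∃ c : Plane, ∫⁻ x in discCap x₀ r e, ‖u x - c‖ₑ ^ 2 ≤ M := by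
    intro e e' he he' hee hA
    have hd : ∀ x ∈ discCap x₀ r e, ∀ y ∈ discCap x₀ r e, ‖x - y‖ₑ ≤ ENNReal.ofReal (6 * r) := by
      intro x hx y hy
      rw [← ofReal_norm, ← dist_eq_norm]
      apply ENNReal.ofReal_le_ofReal
      have h1 := Metric.mem_ball.1 hx.1
      have h2 := Metric.mem_ball.1 hy.1
      linarith [dist_triangle_right x y x₀]
    have hpos : volume (discCap x₀ r e) ≠ 0 := by
      refine ((isOpen_discCap x₀ r e).measure_pos volume ?_).ne'
      exact ⟨_, (ball_subset_discCap_inter hr he he' hee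
        (Metric.mem_ball_self (by positivity))).1⟩
    have hfin : volume (discCap x₀ r e) ≠ ⊤ :=
      ((measure_mono inter_subset_left).trans_lt measure_ball_lt_top).ne
    obtain ⟨c, hc⟩ := h.exists_lintegral_enorm_sub_const_sq_le hu hψ (hsub e)
      (convex_discCap x₀ r e) (isOpen_discCap x₀ r e).measurableSet hpos hfin
      ENNReal.ofReal_ne_top hd
    refine ⟨c, hc.trans ?_⟩
    rw [hM]
    gcongr
  set e₀ : Plane := EuclideanSpace.single 0 1 with he₀
  set e₁ : Plane := EuclideanSpace.single 1 1 with he₁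
  have n0 : ‖e₀‖ = 1 := by simp [he₀]
  have n1 : ‖e₁‖ = 1 := by simp [he₁]
  have n0' : ‖-e₀‖ = 1 := by simp [he₀]
  have n1' : ‖-e₁‖ = 1 := by simp [he₁]
  have i01 : inner ℝ e₀ e₁ = 0 := by simp [he₀, he₁, EuclideanSpace.inner_single_left]
  have i10 : inner ℝ e₁ (-e₀) = 0 := by simp [he₀, he₁, EuclideanSpace.inner_single_left]
  have i01' : inner ℝ (-e₀) (-e₁) = 0 := by simp [he₀, he₁, EuclideanSpace.inner_single_left]
  have i10' : inner ℝ (-e₁) e₀ = 0 := by simp [he₀, he₁, EuclideanSpace.inner_single_left]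
  obtain ⟨c₀, hc₀⟩ := cap e₀ e₁ n0 n1 i01
    ((subset_union_left.trans subset_union_left).trans subset_union_left)
  obtain ⟨c₁, hc₁⟩ := cap e₁ (-e₀) n1 n0' i10
    ((subset_union_right.trans subset_union_left).trans subset_union_left)
  obtain ⟨c₂, hc₂⟩ := cap (-e₀) (-e₁) n0' n1' i01' (subset_union_right.trans subset_union_left)
  obtain ⟨c₃, hc₃⟩ := cap (-e₁) e₀ n1' n0 i10' subset_union_right
  have hcap := fun e => hmeas _ (hsub e)
  have s1 := lintegral_union_enorm_sub_const_sq_le (hcap _) (hcap _) hc₀ hc₁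
    (volume_discCap_le_mul_volume_inter hr n0 n1 i01)
  have hle : ∀ K : ℝ≥0∞, K ≤ (3 + 8 * 36) * K := fun K =>
    le_mul_of_one_le_left zero_le (by norm_num)
  have s2 := lintegral_union_enorm_sub_const_sq_le
    (hmeas _ (union_subset (hsub _) (hsub _))) (hcap _) s1 (hc₂.trans (hle _))
    ((volume_discCap_le_mul_volume_inter hr n1 n0' i10).trans
      (by gcongr; exact subset_union_right))
  have s3 := lintegral_union_enorm_sub_const_sq_le
    (hmeas _ (union_subset (union_subset (hsub _) (hsub _)) (hsub _))) (hcap _) s2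
    ((hc₃.trans (hle _)).trans (hle _))
    ((volume_discCap_le_mul_volume_inter hr n0' n1' i01').trans
      (by gcongr; exact subset_union_right))
  refine ⟨c₀, s3.trans_eq ?_⟩
  rw [mul_assoc (291 ^ 3 : ℝ≥0∞), ← hM]
  norm_num [← mul_assoc]

/-! ### Cut-off test functions -/

theorem integral_fderiv_eq_zero_of_hasCompactSupport {ξ : Plane → ℝ} (hξ : ContDiff ℝ ∞ ξ)
    (hc : HasCompactSupport ξ) (v : Plane) : ∫ x, fderiv ℝ ξ x v = 0 := by
  have hi : Integrable (fun x => fderiv ℝ ξ x v) :=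
    ((hξ.continuous_fderiv (by simp)).clm_apply continuous_const).integrable_of_hasCompactSupport
      (hc.fderiv_apply ℝ v)
  have h := integral_mul_fderiv_eq_neg_fderiv_mul_of_integrable (μ := (volume : Measure Plane))
    (f := fun _ => (1 : ℝ)) (g := ξ) (v := v) (by simp) (by simpa using hi)
    (by simpa using hξ.continuous.integrable_of_hasCompactSupport hc)
    (fun x _ => differentiableAt_const _) (fun x _ => hξ.differentiable (by simp) x)
  simpa using h

theorem jacobianMatrix_smul_sub_const {η : Plane → ℝ} {ψ : Plane → Plane}
    (hη : ContDiff ℝ ∞ η) (hψ : ContDiff ℝ ∞ ψ) (c x : Plane) (i j : Fin 2) :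
    jacobianMatrix (fun x => η x • (ψ x - c)) x i j =
      η x * jacobianMatrix ψ x i j +
        (ψ x i - c i) * fderiv ℝ η x (EuclideanSpace.single j 1) := by
  have h1 := hη.differentiable (by simp) x
  have h2 := hψ.differentiable (by simp) x
  have h := (h1.hasFDerivAt.smul (h2.hasFDerivAt.sub_const c)).fderiv
  simp only [jacobianMatrix, Matrix.of_apply]
  rw [show fderiv ℝ (fun x => η x • (ψ x - c)) x = _ from h]
  simp [mul_comm]

theorem MeasureTheory.MemLp.integrable_mul_of_hasCompactSupport {μ : Measure Plane}
    [IsFiniteMeasure μ] {f g : Plane → ℝ} (hf : MemLp f 2 μ) (hg : Continuous g) (hgc : HasCompactSupport g) :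
    Integrable (fun x => f x * g x) μ := by
  obtain ⟨C, hC⟩ := hg.bounded_above_of_compact_support hgc
  exact (hf.integrable (by norm_num)).mul_bdd hg.aestronglyMeasurable
    (Eventually.of_forall hC)

/-- Cutting off `u - c` by `η` gives an admissible test function: the cut-off smooth
approximants of `u` converge to it. -/
theorem TendstoSobolev.isSobolevZeroWithGrad_smul_sub_const {Ω : Set Plane}
    [IsFiniteMeasure ((volume : Measure Plane).restrict Ω)]
    {u : Plane → Plane} {G : Plane → Matrix (Fin 2) (Fin 2) ℝ} {ψ : ℕ → Plane → Plane}
    (h : TendstoSobolev Ω ψ u G) (hu : IsSobolevWithGrad Ω u G) (hψ : ∀ n, ContDiff ℝ ∞ (ψ n))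
    {η : Plane → ℝ} (hη : ContDiff ℝ ∞ η) (hηc : HasCompactSupport η) (hηΩ : tsupport η ⊆ Ω)
    (c : Plane) :
    IsSobolevZeroWithGrad Ω (fun x => η x • (u x - c))
      (fun x => Matrix.of fun i j =>
        η x * G x i j + (u x i - c i) * fderiv ℝ η x (EuclideanSpace.single j 1)) := by
  have hdc : ∀ j : Fin 2, Continuous fun x => fderiv ℝ η x (EuclideanSpace.single j 1) := fun j =>
    (hη.continuous_fderiv (by simp)).clm_apply continuous_const
  obtain ⟨M, hM⟩ := hη.continuous.bounded_above_of_compact_support hηc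
  obtain ⟨L, hL⟩ := (hη.continuous_fderiv (by simp)).bounded_above_of_compact_support
    (hηc.fderiv ℝ)
  have hL' : ∀ j x, ‖fderiv ℝ η x (EuclideanSpace.single j 1)‖ ≤ L := fun j x => by
    refine ((fderiv ℝ η x).le_opNorm _).trans ?_
    simpa using hL x
  have hucp : MemLp (fun x => u x - c) 2 (volume.restrict Ω) := hu.memLp.sub (memLp_const c)
  have huc : ∀ i, MemLp (fun x => u x i - c i) 2 (volume.restrict Ω) := fun i =>
    hucp.of_le ((EuclideanSpace.proj (𝕜 := ℝ) i).continuous.comp_aestronglyMeasurable hucp.1)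
      (Eventually.of_forall fun x => PiLp.norm_apply_le (u x - c) i)
  refine ⟨⟨?_, fun i j => ?_, fun i j ζ hζ hζc hζΩ => ?_⟩, fun n x => η x • (ψ n x - c),
    fun n => ⟨hη.smul ((hψ n).sub contDiff_const), hηc.smul_right,
      (closure_mono (Function.support_smul_subset_left _ _)).trans hηΩ⟩, ?_, fun i j => ?_⟩
  · refine hucp.of_le_mul (c := M) (hη.continuous.aestronglyMeasurable.smul hucp.1)
      (Eventually.of_forall fun x => ?_)
    rw [norm_smul]
    gcongr
    exact hM x
  · refine MemLp.add ?_ ?_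
    · refine (hu.memLp_grad i j).of_le_mul (c := M)
        (hη.continuous.aestronglyMeasurable.mul (hu.memLp_grad i j).1)
        (Eventually.of_forall fun x => ?_)
      rw [norm_mul]
      gcongr
      exact hM x
    · refine (huc i).of_le_mul (c := L) ((huc i).1.mul (hdc j).aestronglyMeasurable)
        (Eventually.of_forall fun x => ?_)
      rw [norm_mul, mul_comm]
      gcongr
      exact hL' j x
  · set v : Plane := EuclideanSpace.single j 1 with hv
    have hξ : ContDiff ℝ ∞ fun x => η x * ζ x := hη.mul hζ
    have hξc : HasCompactSupport fun x => η x * ζ x := hηc.mul_right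
    have hξΩ : tsupport (fun x => η x * ζ x) ⊆ Ω :=
      (closure_mono (Function.support_mul_subset_left _ _)).trans hηΩ
    have hdξ : ∀ x, fderiv ℝ (fun x => η x * ζ x) x v =
        η x * fderiv ℝ ζ x v + ζ x * fderiv ℝ η x v := fun x => by
      rw [fderiv_fun_mul (hη.differentiable (by simp) x) (hζ.differentiable (by simp) x)]
      simp
    have hζd : Continuous fun x => fderiv ℝ ζ x v :=
      (hζ.continuous_fderiv (by simp)).clm_apply continuous_const
    have hcξ : Continuous fun x => fderiv ℝ (fun x => η x * ζ x) x v :=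
      (hξ.continuous_fderiv (by simp)).clm_apply continuous_const
    have hui : MemLp (fun x => u x i) 2 (volume.restrict Ω) :=
      hu.memLp.of_le ((EuclideanSpace.proj (𝕜 := ℝ) i).continuous.comp_aestronglyMeasurable
        hu.memLp.1) (Eventually.of_forall fun x => PiLp.norm_apply_le (u x) i)
    have hz : ∫ x in Ω, fderiv ℝ (fun x => η x * ζ x) x v = 0 := by
      rw [setIntegral_eq_integral_of_forall_compl_eq_zero]
      · exact integral_fderiv_eq_zero_of_hasCompactSupport hξ hξc v
      · intro x hx
        have : x ∉ tsupport (fderiv ℝ fun x => η x * ζ x) := fun h' =>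
          hx (hξΩ (tsupport_fderiv_subset ℝ h'))
        rw [image_eq_zero_of_notMem_tsupport this]; rfl
    have hw : ∫ x in Ω, (u x i - c i) * fderiv ℝ (fun x => η x * ζ x) x v =
        -∫ x in Ω, G x i j * (η x * ζ x) := by
      rw [← hu.weak_deriv i j _ hξ hξc hξΩ]
      simp_rw [sub_mul]
      rw [integral_sub (hui.integrable_mul_of_hasCompactSupport hcξ (hξc.fderiv_apply ℝ v))
        (MemLp.integrable_mul_of_hasCompactSupport (memLp_const _) hcξ (hξc.fderiv_apply ℝ v)),
        integral_const_mul, hz, mul_zero, sub_zero]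
    have I1 : Integrable (fun x => (u x i - c i) * (η x * fderiv ℝ ζ x v)) (volume.restrict Ω) :=
      (huc i).integrable_mul_of_hasCompactSupport (hη.continuous.mul hζd) hηc.mul_right
    have I2 : Integrable (fun x => (u x i - c i) * (ζ x * fderiv ℝ η x v)) (volume.restrict Ω) :=
      (huc i).integrable_mul_of_hasCompactSupport (hζ.continuous.mul (hdc j)) hζc.mul_right
    have I3 : Integrable (fun x => G x i j * (η x * ζ x)) (volume.restrict Ω) :=
      (hu.memLp_grad i j).integrable_mul_of_hasCompactSupport hξ.continuous hξc
    simp_rw [hdξ, mul_add] at hw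
    rw [integral_add I1 I2] at hw
    have e1 : ∀ x, (η x • (u x - c)) i * fderiv ℝ ζ x v =
        (u x i - c i) * (η x * fderiv ℝ ζ x v) := fun x => by simp; ring
    have e2 : ∀ x, (Matrix.of fun i j =>
        η x * G x i j + (u x i - c i) * fderiv ℝ η x (EuclideanSpace.single j 1)) i j * ζ x =
        G x i j * (η x * ζ x) + (u x i - c i) * (ζ x * fderiv ℝ η x v) := fun x => by
      simp; ring
    simp_rw [e1, e2]
    rw [integral_add I3 I2]
    linarith
  · have hb : ∀ n, eLpNorm (fun x => η x • (ψ n x - c) - η x • (u x - c)) 2 (volume.restrict Ω) ≤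
        ENNReal.ofReal M * eLpNorm (fun x => ψ n x - u x) 2 (volume.restrict Ω) := fun n => by
      refine eLpNorm_le_mul_eLpNorm_of_ae_le_mul (Eventually.of_forall fun x => ?_) 2
      rw [← smul_sub, sub_sub_sub_cancel_right, norm_smul]
      gcongr
      exact hM x
    refine tendsto_of_tendsto_of_tendsto_of_le_of_le tendsto_const_nhds ?_ (fun _ => zero_le) hb
    simpa using ENNReal.Tendsto.const_mul h.1 (Or.inr ENNReal.ofReal_ne_top)
  · have hb : ∀ n, eLpNorm (fun x => jacobianMatrix (fun x => η x • (ψ n x - c)) x i j -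
          (Matrix.of fun i j => η x * G x i j +
            (u x i - c i) * fderiv ℝ η x (EuclideanSpace.single j 1)) i j) 2
          (volume.restrict Ω) ≤
        ENNReal.ofReal M *
          eLpNorm (fun x => jacobianMatrix (ψ n) x i j - G x i j) 2 (volume.restrict Ω) +
        ENNReal.ofReal L * eLpNorm (fun x => ψ n x - u x) 2 (volume.restrict Ω) := fun n => by
      have hsplit : (fun x => jacobianMatrix (fun x => η x • (ψ n x - c)) x i j -
          (Matrix.of fun i j => η x * G x i j +
            (u x i - c i) * fderiv ℝ η x (EuclideanSpace.single j 1)) i j) =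
          (fun x => η x * (jacobianMatrix (ψ n) x i j - G x i j)) +
            fun x => (ψ n x i - u x i) * fderiv ℝ η x (EuclideanSpace.single j 1) := by
        ext x
        rw [jacobianMatrix_smul_sub_const hη (hψ n)]
        simp only [Matrix.of_apply, Pi.add_apply]
        ring
      have hJ : AEStronglyMeasurable (fun x => jacobianMatrix (ψ n) x i j - G x i j)
          (volume.restrict Ω) :=
        (continuous_jacobianMatrix (hψ n) i j).aestronglyMeasurable.sub (hu.memLp_grad i j).1
      have hd : AEStronglyMeasurable (fun x => ψ n x i - u x i) (volume.restrict Ω) :=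
        (EuclideanSpace.proj (𝕜 := ℝ) i).continuous.comp_aestronglyMeasurable
          ((hψ n).continuous.aestronglyMeasurable.sub hu.memLp.1)
      rw [hsplit]
      refine (eLpNorm_add_le (hη.continuous.aestronglyMeasurable.mul hJ)
        (hd.mul (hdc j).aestronglyMeasurable) (by norm_num)).trans ?_
      gcongr
      · refine eLpNorm_le_mul_eLpNorm_of_ae_le_mul (Eventually.of_forall fun x => ?_) 2
        rw [Pi.mul_apply, norm_mul]
        gcongr
        exact hM x
      · refine eLpNorm_le_mul_eLpNorm_of_ae_le_mul (Eventually.of_forall fun x => ?_) 2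
        rw [Pi.mul_apply, norm_mul, mul_comm]
        exact mul_le_mul (hL' j x) (PiLp.norm_apply_le (ψ n x - u x) i) (norm_nonneg _)
          ((norm_nonneg _).trans (hL' j x))
    refine tendsto_of_tendsto_of_tendsto_of_le_of_le tendsto_const_nhds ?_ (fun _ => zero_le) hb
    simpa using (ENNReal.Tendsto.const_mul (h.2 i j) (Or.inr ENNReal.ofReal_ne_top)).add
      (ENNReal.Tendsto.const_mul h.1 (Or.inr ENNReal.ofReal_ne_top))

/-! ### Hole filling -/

/-- Scaled cut-off functions, with a gradient bound `L / r` that is uniform in the scale. -/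
theorem exists_cutoff : ∃ L : ℝ, ∀ (x₀ : Plane) (r : ℝ), 0 < r → ∃ η : Plane → ℝ,
    ContDiff ℝ ∞ η ∧ HasCompactSupport η ∧ tsupport η ⊆ Metric.ball x₀ (3 * r) ∧
    (∀ x, 0 ≤ η x) ∧ (∀ x ∈ Metric.ball x₀ (2 * r), η x = 1) ∧
    (∀ x (j : Fin 2), |fderiv ℝ η x (EuclideanSpace.single j 1)| ≤ L / r) ∧
    ∀ x ∉ capAnnulus x₀ r, fderiv ℝ η x = 0 := by
  let f : ContDiffBump (0 : Plane) := ⟨2, 5 / 2, by norm_num, by norm_num⟩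
  have hf : ContDiff ℝ ∞ f := f.contDiff
  obtain ⟨L, hL⟩ := (hf.continuous_fderiv (by simp)).bounded_above_of_compact_support
    (f.hasCompactSupport.fderiv ℝ)
  refine ⟨L, fun x₀ r hr => ?_⟩
  have hn : ∀ x : Plane, ‖r⁻¹ • (x - x₀)‖ = dist x x₀ / r := fun x => by
    rw [norm_smul, norm_inv, Real.norm_of_nonneg hr.le, dist_eq_norm]; ring
  set η : Plane → ℝ := fun x => f (r⁻¹ • (x - x₀)) with hη
  have hsm : ContDiff ℝ ∞ η := hf.comp (by fun_prop)
  have hone : ∀ x ∈ Metric.ball x₀ (2 * r), η x = 1 := fun x hx => by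
    refine f.one_of_mem_closedBall ?_
    rw [mem_closedBall_zero_iff, hn, div_le_iff₀ hr]
    exact (Metric.mem_ball.1 hx).le
  have hzero : ∀ x ∉ Metric.closedBall x₀ (5 / 2 * r), η x = 0 := fun x hx => by
    refine f.zero_of_le_dist ?_
    rw [dist_zero_right, hn, le_div_iff₀ hr]
    rw [Metric.mem_closedBall, not_le] at hx
    exact hx.le
  have hts : tsupport η ⊆ Metric.ball x₀ (3 * r) := by
    refine (closure_minimal (fun x hx => ?_) Metric.isClosed_closedBall).trans
      (Metric.closedBall_subset_ball (by linarith : 5 / 2 * r < 3 * r))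
    by_contra h
    exact hx (hzero x h)
  refine ⟨η, hsm, HasCompactSupport.intro (isCompact_closedBall _ _) hzero, hts,
    fun x => f.nonneg, hone, fun x j => ?_, fun x hx => ?_⟩
  · have hd : HasFDerivAt (fun x : Plane => r⁻¹ • (x - x₀))
        (r⁻¹ • ContinuousLinearMap.id ℝ Plane) x :=
      ((hasFDerivAt_id x).sub_const x₀).const_smul r⁻¹
    have hc := ((hf.differentiable (by simp) (r⁻¹ • (x - x₀))).hasFDerivAt.comp x hd).fderiv
    rw [show fderiv ℝ η x = _ from hc, ← Real.norm_eq_abs]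
    simp only [ContinuousLinearMap.comp_smul, ContinuousLinearMap.comp_id,
      _root_.smul_apply, norm_smul, norm_inv, Real.norm_of_nonneg hr.le]
    rw [div_eq_inv_mul]
    gcongr
    refine (ContinuousLinearMap.le_opNorm _ _).trans ?_
    simpa using hL (r⁻¹ • (x - x₀))
  · by_cases h2 : x ∈ Metric.ball x₀ (2 * r)
    · have : η =ᶠ[𝓝 x] fun _ => 1 := by
        filter_upwards [Metric.isOpen_ball.mem_nhds h2] with y hy using hone y hy
      rw [this.fderiv_eq]
      simp
    · have h3 : x ∉ Metric.ball x₀ (3 * r) := fun h3 =>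
        hx (ball_diff_ball_subset_capAnnulus x₀ hr ⟨h3, h2⟩)
      exact image_eq_zero_of_notMem_tsupport fun h => h3 (hts (tsupport_fderiv_subset ℝ h))

theorem IsSobolevWithGrad.integrableOn_frobInner {Ω : Set Plane} {u : Plane → Plane}
    {G : Plane → Matrix (Fin 2) (Fin 2) ℝ} (hu : IsSobolevWithGrad Ω u G) :
    IntegrableOn (fun x => frobInner (G x) (G x)) Ω :=
  integrable_finsetSum _ fun i _ => integrable_finsetSum _ fun j _ =>
    (hu.memLp_grad i j).integrable_mul (hu.memLp_grad i j)

/-- Since `ρ'` is bounded, the Euler-Lagrange integrand is as integrable as the gradient. -/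
theorem IsSobolevWithGrad.memLp_add_smul_cof {Ω : Set Plane} {u : Plane → Plane}
    {G : Plane → Matrix (Fin 2) (Fin 2) ℝ} (hu : IsSobolevWithGrad Ω u G)
    {γ s₀ κ : ℝ} {ρ : ℝ → ℝ} (hρ : IsDensity γ s₀ κ ρ) (i j : Fin 2) :
    MemLp (fun x => (G x + deriv ρ (G x).det • cof (G x)) i j) 2 (volume.restrict Ω) := by
  have hg := hu.memLp_grad
  have hdet : AEStronglyMeasurable (fun x => deriv ρ (G x).det) (volume.restrict Ω) := by
    refine (hρ.smooth.continuous_deriv (by simp)).comp_aestronglyMeasurable ?_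
    simp_rw [Matrix.det_fin_two]
    exact ((hg 0 0).1.mul (hg 1 1).1).sub ((hg 0 1).1.mul (hg 1 0).1)
  have hmul : ∀ {f : Plane → ℝ}, MemLp f 2 (volume.restrict Ω) →
      MemLp (fun x => deriv ρ (G x).det * f x) 2 (volume.restrict Ω) := fun {f} hf => by
    refine hf.of_le_mul (c := γ) (hdet.mul hf.1) (Eventually.of_forall fun x => ?_)
    rw [norm_mul, Real.norm_of_nonneg (hρ.deriv_mem_Icc _).1]
    gcongr
    exact (hρ.deriv_mem_Icc _).2
  have hcof : ∀ i j, MemLp (fun x => cof (G x) i j) 2 (volume.restrict Ω) := by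
    intro i j
    fin_cases i <;> fin_cases j <;> simp only [cof, Matrix.adjugate_fin_two]
    · exact hg 1 1
    · exact (hg 1 0).neg
    · exact (hg 0 1).neg
    · exact hg 0 0
  exact (hg i j).add (hmul (hcof i j))

theorem TendstoSobolev.exists_integral_capAnnulus_le {Ω : Set Plane}
    [IsFiniteMeasure ((volume : Measure Plane).restrict Ω)]
    {u : Plane → Plane} {G : Plane → Matrix (Fin 2) (Fin 2) ℝ} {ψ : ℕ → Plane → Plane}
    (h : TendstoSobolev Ω ψ u G) (hu : IsSobolevWithGrad Ω u G) (hψ : ∀ n, ContDiff ℝ ∞ (ψ n))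
    {x₀ : Plane} {r : ℝ} (hr : 0 < r) (hΩ : Metric.ball x₀ (3 * r) ⊆ Ω) :
    ∃ c : Plane, ∫ x in capAnnulus x₀ r, ‖u x - c‖ ^ 2 ≤
      291 ^ 3 * 144 * r ^ 2 * ∫ x in capAnnulus x₀ r, frobInner (G x) (G x) := by
  obtain ⟨c, hc⟩ := h.exists_lintegral_capAnnulus_le hu hψ hr hΩ
  refine ⟨c, ?_⟩
  have hA : capAnnulus x₀ r ⊆ Ω := (capAnnulus_subset_ball x₀ r).trans hΩ
  have hI : IntegrableOn (fun x => frobInner (G x) (G x)) (capAnnulus x₀ r) :=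
    hu.integrableOn_frobInner.mono_set hA
  have hI2 : IntegrableOn (fun x => ‖u x - c‖ ^ 2) (capAnnulus x₀ r) :=
    IntegrableOn.mono_set (s := capAnnulus x₀ r) (t := Ω)
      ((hu.memLp.sub (memLp_const c)).integrable_norm_pow (by norm_num)) hA
  have h0 : 0 ≤ ∫ x in capAnnulus x₀ r, frobInner (G x) (G x) :=
    integral_nonneg fun x => frobInner_self_nonneg _
  rw [← ENNReal.ofReal_le_ofReal_iff (by positivity), ENNReal.ofReal_mul (by positivity),
    ofReal_integral_eq_lintegral_ofReal hI2 (Eventually.of_forall fun x => by positivity),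
    ofReal_integral_eq_lintegral_ofReal hI
      (Eventually.of_forall fun x => frobInner_self_nonneg _)]
  have e1 : ∀ x, ENNReal.ofReal (‖u x - c‖ ^ 2) = ‖u x - c‖ₑ ^ 2 := fun x => by
    rw [ENNReal.ofReal_pow (norm_nonneg _), ofReal_norm]
  have e2 : ENNReal.ofReal (291 ^ 3 * 144 * r ^ 2) =
      291 ^ 3 * (4 * ENNReal.ofReal (6 * r) ^ 2) := by
    rw [← ENNReal.ofReal_pow (by positivity),
      show (291 : ℝ) ^ 3 * 144 * r ^ 2 = 291 ^ 3 * (4 * (6 * r) ^ 2) by ring,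
      ENNReal.ofReal_mul (by norm_num), ENNReal.ofReal_mul (by norm_num)]
    norm_num
  simp_rw [e1, e2]
  exact hc

/-- Widman's hole-filling inequality: the Dirichlet energy decays geometrically on concentric
discs, at a rate that depends on `γ` only. -/
theorem exists_integral_ball_le_mul_integral_ball (γ : ℝ) : ∃ θ < (1 : ℝ),
    ∀ (Ω : Set Plane), MeasurableSet Ω → volume Ω ≠ ⊤ →
    ∀ (s₀ κ : ℝ) (ρ : ℝ → ℝ), IsDensity γ s₀ κ ρ →
    ∀ (u : Plane → Plane) (G : Plane → Matrix (Fin 2) (Fin 2) ℝ) (ψ : ℕ → Plane → Plane),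
      IsSobolevWithGrad Ω u G → (∀ n, ContDiff ℝ ∞ (ψ n)) → TendstoSobolev Ω ψ u G →
      (∀ (φ : Plane → Plane) (H : Plane → Matrix (Fin 2) (Fin 2) ℝ),
        IsSobolevZeroWithGrad Ω φ H →
        ∫ x in Ω, frobInner (G x + deriv ρ (G x).det • cof (G x)) (H x) = 0) →
    ∀ (x₀ : Plane) (r : ℝ), 0 < r → Metric.ball x₀ (3 * r) ⊆ Ω →
      ∫ x in Metric.ball x₀ r, frobInner (G x) (G x) ≤
        θ * ∫ x in Metric.ball x₀ (3 * r), frobInner (G x) (G x) := by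
  obtain ⟨L, hcut⟩ := exists_cutoff
  set C : ℝ := 1 + γ ^ 2 + 2 * L ^ 2 * (291 ^ 3 * 144) with hC
  have hC0 : 0 < C := by positivity
  refine ⟨C / (1 + C), by rw [div_lt_one (by positivity)]; linarith, ?_⟩
  intro Ω hΩm hΩf s₀ κ ρ hρ u G ψ hu hψ h hEL x₀ r hr hΩ
  have : IsFiniteMeasure ((volume : Measure Plane).restrict Ω) := ⟨by simpa using hΩf.lt_top⟩
  obtain ⟨η, hη, hηc, hηs, hη0, hη1, hηL, hηA⟩ := hcut x₀ r hr
  obtain ⟨c, hc⟩ := h.exists_integral_capAnnulus_le hu hψ hr hΩ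
  set A := capAnnulus x₀ r with hAdef
  have hAΩ : A ⊆ Ω := (capAnnulus_subset_ball x₀ r).trans hΩ
  have hAm : MeasurableSet A := (isOpen_capAnnulus x₀ r).measurableSet
  have hBΩ : Metric.ball x₀ r ⊆ Ω := (Metric.ball_subset_ball (by linarith)).trans hΩ
  have hBm : MeasurableSet (Metric.ball x₀ r) := Metric.isOpen_ball.measurableSet
  have hdisj : Disjoint (Metric.ball x₀ r) A := disjoint_ball_capAnnulus x₀ r
  have hI := hu.integrableOn_frobInner
  have hI2 : IntegrableOn (fun x => ‖u x - c‖ ^ 2) Ω :=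
    (hu.memLp.sub (memLp_const c)).integrable_norm_pow (by norm_num)
  have htest := h.isSobolevZeroWithGrad_smul_sub_const hu hψ hη hηc (hηs.trans hΩ) c
  have h0 := hEL _ _ htest
  set F : Plane → ℝ := fun x => frobInner (G x + deriv ρ (G x).det • cof (G x))
    (Matrix.of fun i j =>
      η x * G x i j + (u x i - c i) * fderiv ℝ η x (EuclideanSpace.single j 1)) with hF
  have hFI : Integrable F (volume.restrict Ω) :=
    integrable_finsetSum _ fun i _ => integrable_finsetSum _ fun j _ =>
      (hu.memLp_add_smul_cof hρ i j).integrable_mul (htest.1.memLp_grad i j)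
  set R : Plane → ℝ := fun x => (Metric.ball x₀ r).indicator (fun x => frobInner (G x) (G x)) x -
    A.indicator (fun x => (1 + γ ^ 2) * frobInner (G x) (G x) +
      2 * L ^ 2 / r ^ 2 * ‖u x - c‖ ^ 2) x with hR
  have hIA : IntegrableOn (fun x => (1 + γ ^ 2) * frobInner (G x) (G x) +
      2 * L ^ 2 / r ^ 2 * ‖u x - c‖ ^ 2) Ω := (hI.const_mul _).add (hI2.const_mul _)
  have hRI : Integrable R (volume.restrict Ω) := (hI.indicator hBm).sub (hIA.indicator hAm)
  -- Coercivity gives the energy on the inner disc; the remainder lives on the annulus, where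
  -- the gradient of the cut-off does not vanish.
  have hpt : ∀ x, R x ≤ F x := by
    intro x
    set b : Fin 2 → ℝ := fun j => fderiv ℝ η x (EuclideanSpace.single j 1) with hb
    set a : Fin 2 → ℝ := fun i => u x i - c i with ha
    set t := deriv ρ (G x).det with ht
    have hsplit : F x = η x * frobInner (G x + t • cof (G x)) (G x) +
        frobInner (G x + t • cof (G x)) (Matrix.of fun i j => a i * b j) := by
      simp only [hF, frobInner, Fin.sum_univ_two, Matrix.of_apply]
      ring
    have hcoer := frobInner_le_frobInner_add_smul_cof (G x) (hρ.deriv_mul_self_nonneg _)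
    have hrank := neg_frobInner_rankOne_le (G x) (hρ.deriv_mem_Icc (G x).det) a b
    have hnn := frobInner_self_nonneg (G x)
    have hηF : 0 ≤ η x * frobInner (G x + t • cof (G x)) (G x) :=
      mul_nonneg (hη0 x) (hnn.trans hcoer)
    by_cases hxA : x ∈ A
    · have hxB : x ∉ Metric.ball x₀ r := fun h' => Set.disjoint_left.1 hdisj h' hxA
      have ha2 : a 0 ^ 2 + a 1 ^ 2 = ‖u x - c‖ ^ 2 := by
        simp [ha, EuclideanSpace.norm_sq_eq, Fin.sum_univ_two]
      have hbj : ∀ j, b j ^ 2 ≤ (L / r) ^ 2 := fun j => by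
        rw [← sq_abs]
        gcongr
        exact hηL x j
      have hb2 : b 0 ^ 2 + b 1 ^ 2 ≤ 2 * L ^ 2 / r ^ 2 := by
        have h0 := hbj 0
        have h1 := hbj 1
        rw [div_pow] at h0 h1
        rw [mul_div_assoc]
        linarith
      have := mul_le_mul_of_nonneg_left hb2 (sq_nonneg ‖u x - c‖)
      simp only [hR, indicator_of_notMem hxB, indicator_of_mem hxA, hsplit]
      rw [ha2] at hrank
      linarith
    · have hb0 : b = 0 := by ext j; simp [hb, hηA x hxA]
      have hz : frobInner (G x + t • cof (G x)) (Matrix.of fun i j => a i * b j) = 0 := by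
        simp [frobInner, hb0]
      rw [hsplit, hz, add_zero]
      simp only [hR, indicator_of_notMem hxA, sub_zero]
      by_cases hxB : x ∈ Metric.ball x₀ r
      · rw [indicator_of_mem hxB, hη1 x (Metric.ball_subset_ball (by linarith) hxB), one_mul]
        exact hcoer
      · rwa [indicator_of_notMem hxB]
  have hint : ∫ x in Ω, R x ≤ 0 := h0 ▸ integral_mono hRI hFI hpt
  rw [show ∫ x in Ω, R x = _ from integral_sub (hI.indicator hBm) (hIA.indicator hAm),
    setIntegral_indicator hBm, setIntegral_indicator hAm, inter_eq_self_of_subset_right hBΩ,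
    inter_eq_self_of_subset_right hAΩ,
    integral_add ((hI.mono_set hAΩ).const_mul _) ((hI2.mono_set hAΩ).const_mul _),
    integral_const_mul, integral_const_mul] at hint
  set E := ∫ x in Metric.ball x₀ r, frobInner (G x) (G x) with hE
  set EA := ∫ x in A, frobInner (G x) (G x) with hEA
  have hcap : E ≤ C * EA := by
    have h1 : 2 * L ^ 2 / r ^ 2 * ∫ x in A, ‖u x - c‖ ^ 2 ≤ 2 * L ^ 2 / r ^ 2 *
        (291 ^ 3 * 144 * r ^ 2 * EA) := by gcongr
    have h2 : 2 * L ^ 2 / r ^ 2 * (291 ^ 3 * 144 * r ^ 2 * EA) =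
        2 * L ^ 2 * (291 ^ 3 * 144) * EA := by field_simp
    rw [hC, add_mul]
    linarith
  have hsum : E + EA ≤ ∫ x in Metric.ball x₀ (3 * r), frobInner (G x) (G x) := by
    rw [hE, hEA, ← setIntegral_union hdisj hAm (hI.mono_set hBΩ) (hI.mono_set hAΩ)]
    exact setIntegral_mono_set (hI.mono_set hΩ)
      (Eventually.of_forall fun x => frobInner_self_nonneg _)
      (Eventually.of_forall (union_subset (Metric.ball_subset_ball (by linarith))
        (capAnnulus_subset_ball x₀ r)))
  -- Filling the hole: add `C * E` to both sides of `E ≤ C * EA`.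
  rw [div_mul_eq_mul_div, le_div_iff₀ (by positivity)]
  nlinarith

/-! ### Morrey's Dirichlet growth theorem -/

theorem enorm_setAverage_sub_sq_mul_le {u : Plane → Plane} {T : Set Plane}
    (h0 : volume T ≠ 0) (hfin : volume T ≠ ⊤) (hu : IntegrableOn u T) (c : Plane) :
    ‖(⨍ x in T, u x) - c‖ₑ ^ 2 * volume T ≤ ∫⁻ x in T, ‖u x - c‖ₑ ^ 2 := by
  have hsub : ∫ x in T, (u x - c) = volume.real T • ((⨍ x in T, u x) - c) := by
    rw [integral_sub hu (integrableOn_const hfin), setIntegral_const, smul_sub,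
      measure_smul_setAverage _ hfin]
  have h1 : volume T * ‖(⨍ x in T, u x) - c‖ₑ ≤ ∫⁻ x in T, ‖u x - c‖ₑ := by
    calc volume T * ‖(⨍ x in T, u x) - c‖ₑ = ‖∫ x in T, (u x - c)‖ₑ := by
          rw [hsub, enorm_smul, Real.enorm_of_nonneg measureReal_nonneg, ofReal_measureReal hfin]
      _ ≤ _ := enorm_integral_le_lintegral_enorm _
  have h2 : volume T * (‖(⨍ x in T, u x) - c‖ₑ ^ 2 * volume T) ≤
      volume T * ∫⁻ x in T, ‖u x - c‖ₑ ^ 2 := by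
    calc volume T * (‖(⨍ x in T, u x) - c‖ₑ ^ 2 * volume T)
        = (volume T * ‖(⨍ x in T, u x) - c‖ₑ) ^ 2 := by ring
      _ ≤ (∫⁻ x in T, ‖u x - c‖ₑ) ^ 2 := by gcongr
      _ ≤ _ := by
        have hm : AEStronglyMeasurable (fun x => u x - c) (volume.restrict T) :=
          hu.1.sub aestronglyMeasurable_const
        simpa using sq_lintegral_le_measure_mul_lintegral_sq hm.enorm
  exact (ENNReal.mul_le_mul_iff_right h0 hfin).1 h2

/-- Mean values over two comparable discs inside `B(x, R)` differ by the square root of the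
Dirichlet energy on `B(x, R)`; in the plane there is no further power of `R`. -/
theorem TendstoSobolev.norm_setAverage_sub_setAverage_le {Ω : Set Plane}
    [IsFiniteMeasure ((volume : Measure Plane).restrict Ω)]
    {u : Plane → Plane} {G : Plane → Matrix (Fin 2) (Fin 2) ℝ} {ψ : ℕ → Plane → Plane}
    (h : TendstoSobolev Ω ψ u G) (hu : IsSobolevWithGrad Ω u G) (hψ : ∀ n, ContDiff ℝ ∞ (ψ n))
    {x z z' : Plane} {R s s' : ℝ} (hR : 0 < R) (hΩ : Metric.ball x R ⊆ Ω)
    (hs : R ≤ 9 * s) (hs' : R ≤ 9 * s') (hz : Metric.closedBall z s ⊆ Metric.ball x R)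
    (hz' : Metric.closedBall z' s' ⊆ Metric.ball x R) :
    ‖(⨍ y in Metric.closedBall z s, u y) - ⨍ y in Metric.closedBall z' s', u y‖ ≤
      72 * √(∫ y in Metric.ball x R, frobInner (G y) (G y)) := by
  set E := ∫ y in Metric.ball x R, frobInner (G y) (G y) with hE
  have hE0 : 0 ≤ E := integral_nonneg fun _ => frobInner_self_nonneg _
  have hd : ∀ y ∈ Metric.ball x R, ∀ w ∈ Metric.ball x R, ‖y - w‖ₑ ≤ ENNReal.ofReal (2 * R) := by
    intro y hy w hw
    rw [← ofReal_norm, ← dist_eq_norm]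
    apply ENNReal.ofReal_le_ofReal
    linarith [dist_triangle_right y w x, Metric.mem_ball.1 hy, Metric.mem_ball.1 hw]
  obtain ⟨c, hc⟩ := h.exists_lintegral_enorm_sub_const_sq_le hu hψ hΩ (convex_ball x R)
    Metric.isOpen_ball.measurableSet (Metric.measure_ball_pos volume x hR).ne'
    measure_ball_lt_top.ne ENNReal.ofReal_ne_top hd
  rw [← ofReal_integral_eq_lintegral_ofReal (hu.integrableOn_frobInner.mono_set hΩ)
    (Eventually.of_forall fun _ => frobInner_self_nonneg _), ← hE] at hc
  have key : ∀ (z : Plane) (s : ℝ), R ≤ 9 * s → Metric.closedBall z s ⊆ Metric.ball x R →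
      ‖(⨍ y in Metric.closedBall z s, u y) - c‖ ≤ 36 * √E := by
    intro z s hs hz
    have hs0 : 0 < s := by linarith
    have hint : IntegrableOn u (Metric.closedBall z s) :=
      IntegrableOn.mono_set (t := Ω) (hu.memLp.integrable (by norm_num)) (hz.trans hΩ)
    have h1 := (enorm_setAverage_sub_sq_mul_le
      (Metric.measure_closedBall_pos volume z hs0).ne' measure_closedBall_lt_top.ne hint c).trans
      ((lintegral_mono_set hz).trans hc)
    set D := ‖(⨍ y in Metric.closedBall z s, u y) - c‖ with hD
    have hD0 : 0 ≤ D := norm_nonneg _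
    rw [Measure.addHaar_closedBall_eq_addHaar_ball, EuclideanSpace.volume_ball_fin_two,
      ← ofReal_norm, ← hD, ← ENNReal.ofReal_pow hD0, ← ENNReal.ofReal_pow hs0.le,
      ← ENNReal.ofReal_pow (by positivity : 0 ≤ 2 * R),
      ← ENNReal.ofReal_mul (by positivity : 0 ≤ s ^ 2),
      ← ENNReal.ofReal_mul (by positivity : 0 ≤ D ^ 2),
      show (4 : ℝ≥0∞) = ENNReal.ofReal 4 by simp, ← ENNReal.ofReal_mul (by norm_num),
      ← ENNReal.ofReal_mul (by positivity), ENNReal.ofReal_le_ofReal_iff (by positivity)] at h1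
    have h2 : D ^ 2 * s ^ 2 ≤ 36 ^ 2 * E * s ^ 2 := by
      have hp : D ^ 2 * s ^ 2 * 1 ≤ D ^ 2 * s ^ 2 * Real.pi := by
        gcongr
        linarith [Real.pi_gt_three]
      have hRs : R ^ 2 ≤ (9 * s) ^ 2 := by gcongr
      nlinarith [mul_le_mul_of_nonneg_right hRs hE0]
    have h3 : D ^ 2 ≤ 36 ^ 2 * E := le_of_mul_le_mul_right h2 (by positivity)
    refine le_of_sq_le_sq ?_ (by positivity)
    rw [mul_pow, Real.sq_sqrt hE0]
    exact h3
  have k1 := key z s hs hz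
  have k2 := key z' s' hs' hz'
  calc _ = ‖((⨍ y in Metric.closedBall z s, u y) - c) -
        ((⨍ y in Metric.closedBall z' s', u y) - c)‖ := by rw [sub_sub_sub_cancel_right]
    _ ≤ _ := norm_sub_le _ _
    _ ≤ _ := by linarith

/-- On a compact set, a Hölder estimate at small distances is a Hölder estimate. -/
theorem exists_holderOnWith_of_forall_dist_le {X Y : Type*} [PseudoMetricSpace X]
    [PseudoMetricSpace Y] {K : Set X} (hK : IsCompact K) {v : X → Y} {C δ : ℝ} {α : ℝ≥0}
    (hα : 0 < α) (hδ : 0 < δ)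
    (h : ∀ x ∈ K, ∀ y ∈ K, dist x y ≤ δ → dist (v x) (v y) ≤ C * dist x y ^ (α : ℝ)) :
    ∃ C' : ℝ≥0, HolderOnWith C' α v K := by
  have hα' : (0 : ℝ) < α := hα
  have hcont : ContinuousOn v K := by
    intro x hx
    rw [ContinuousWithinAt, tendsto_iff_dist_tendsto_zero]
    have hlim : Tendsto (fun y => C * dist y x ^ (α : ℝ)) (𝓝[K] x) (𝓝 0) := by
      have h1 : Tendsto (fun y => dist y x) (𝓝[K] x) (𝓝 0) := by
        have := (continuous_id.dist (continuous_const (y := x))).tendsto x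
        simp only [id, dist_self] at this
        exact this.mono_left nhdsWithin_le_nhds
      have h2 := (h1.rpow_const (p := (α : ℝ)) (Or.inr hα'.le)).const_mul C
      rwa [Real.zero_rpow hα'.ne', mul_zero] at h2
    refine squeeze_zero' (Eventually.of_forall fun _ => dist_nonneg) ?_ hlim
    filter_upwards [self_mem_nhdsWithin,
      mem_nhdsWithin_of_mem_nhds (Metric.closedBall_mem_nhds x hδ)] with y hy hyx
    exact h y hy x hx hyx
  obtain ⟨B, hB⟩ := Metric.isBounded_iff.1 (hK.image_of_continuousOn hcont).isBounded
  set C' : ℝ := |C| + |B| / δ ^ (α : ℝ) with hC'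
  have hC'0 : 0 ≤ C' := by positivity
  refine ⟨C'.toNNReal, fun x hx y hy => ?_⟩
  have hreal : dist (v x) (v y) ≤ C' * dist x y ^ (α : ℝ) := by
    rw [hC', add_mul]
    rcases le_or_gt (dist x y) δ with hd | hd
    · have h1 := h x hx y hy hd
      have h2 : C * dist x y ^ (α : ℝ) ≤ |C| * dist x y ^ (α : ℝ) := by
        gcongr
        exact le_abs_self C
      have h3 : 0 ≤ |B| / δ ^ (α : ℝ) * dist x y ^ (α : ℝ) := by positivity
      linarith
    · have h1 : dist (v x) (v y) ≤ |B| :=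
        (hB (mem_image_of_mem v hx) (mem_image_of_mem v hy)).trans (le_abs_self B)
      have h2 : |B| ≤ |B| / δ ^ (α : ℝ) * dist x y ^ (α : ℝ) := by
        rw [div_mul_eq_mul_div, le_div_iff₀ (by positivity)]
        gcongr
      have h3 : 0 ≤ |C| * dist x y ^ (α : ℝ) := by positivity
      linarith
  rw [edist_dist, edist_dist, ENNReal.ofReal_rpow_of_nonneg dist_nonneg hα'.le,
    ← ENNReal.ofReal, ← ENNReal.ofReal_mul hC'0]
  exact ENNReal.ofReal_le_ofReal hreal

/-- Geometric decay of the Dirichlet energy on the discs of radii `3⁻ᵏ` forces Hölder continuity.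
The continuous representative is the limit of the mean values over these discs. -/
theorem TendstoSobolev.isLocallyHolder {Ω : Set Plane} (hΩo : IsOpen Ω) (hΩf : volume Ω ≠ ⊤)
    {u : Plane → Plane} {G : Plane → Matrix (Fin 2) (Fin 2) ℝ} {ψ : ℕ → Plane → Plane}
    (h : TendstoSobolev Ω ψ u G) (hu : IsSobolevWithGrad Ω u G) (hψ : ∀ n, ContDiff ℝ ∞ (ψ n))
    {α : ℝ≥0} (hα : 0 < α) {θ : ℝ} (hθ : θ ≤ ((1 / 3 : ℝ) ^ (α : ℝ)) ^ 2)
    (hdecay : ∀ (x : Plane) (r : ℝ), 0 < r → Metric.ball x (3 * r) ⊆ Ω →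
      ∫ y in Metric.ball x r, frobInner (G y) (G y) ≤
        θ * ∫ y in Metric.ball x (3 * r), frobInner (G y) (G y)) :
    IsLocallyHolder Ω α u := by
  have : IsFiniteMeasure ((volume : Measure Plane).restrict Ω) := ⟨by simpa using hΩf.lt_top⟩
  have hα' : (0 : ℝ) < α := hα
  set p : ℝ := (1 / 3 : ℝ) ^ (α : ℝ) with hp
  have hp0 : 0 < p := by positivity
  have hp1 : p < 1 := Real.rpow_lt_one (by norm_num) (by norm_num) hα'
  set E₀ := ∫ y in Ω, frobInner (G y) (G y) with hE₀
  have hI := hu.integrableOn_frobInner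
  have hnn : ∀ y, 0 ≤ frobInner (G y) (G y) := fun y => frobInner_self_nonneg _
  set a : ℕ → Plane → Plane := fun k x => ⨍ y in Metric.closedBall x ((1 / 3 : ℝ) ^ k), u y
    with ha
  have hr0 : ∀ k : ℕ, (0 : ℝ) < (1 / 3) ^ k := fun k => by positivity
  have hrs : ∀ k : ℕ, (1 / 3 : ℝ) ^ (k + 1) = (1 / 3) ^ k / 3 := fun k => by rw [pow_succ]; ring
  have henergy : ∀ (m : ℕ) (x : Plane), Metric.ball x ((1 / 3 : ℝ) ^ m) ⊆ Ω → ∀ n : ℕ,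
      √(∫ y in Metric.ball x ((1 / 3 : ℝ) ^ (m + n)), frobInner (G y) (G y)) ≤ √E₀ * p ^ n := by
    intro m x hx n
    have h1 : ∫ y in Metric.ball x ((1 / 3 : ℝ) ^ (m + n)), frobInner (G y) (G y) ≤
        E₀ * (p ^ 2) ^ n := by
      induction n with
      | zero =>
        rw [pow_zero, mul_one]
        exact setIntegral_mono_set hI (Eventually.of_forall hnn) (Eventually.of_forall hx)
      | succ n ih =>
        have h3 : 3 * (1 / 3 : ℝ) ^ (m + (n + 1)) = (1 / 3) ^ (m + n) := by
          rw [← add_assoc, hrs]; ring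
        have hsub : Metric.ball x ((1 / 3 : ℝ) ^ (m + n)) ⊆ Ω :=
          (Metric.ball_subset_ball
            (pow_le_pow_of_le_one (by norm_num) (by norm_num) (by omega))).trans hx
        have h2 := hdecay x ((1 / 3 : ℝ) ^ (m + (n + 1))) (hr0 _) (by rwa [h3])
        rw [h3] at h2
        calc _ ≤ _ := h2
          _ ≤ p ^ 2 * (E₀ * (p ^ 2) ^ n) :=
            mul_le_mul hθ ih (integral_nonneg hnn) (by positivity)
          _ = _ := by ring
    calc _ ≤ √(E₀ * (p ^ 2) ^ n) := Real.sqrt_le_sqrt h1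
      _ = _ := by
        rw [Real.sqrt_mul (integral_nonneg hnn), ← pow_mul, mul_comm 2 n, pow_mul,
          Real.sqrt_sq (by positivity)]
  have hsubΩ : ∀ (m : ℕ) (x : Plane), Metric.ball x ((1 / 3 : ℝ) ^ m) ⊆ Ω → ∀ n : ℕ,
      Metric.ball x ((1 / 3 : ℝ) ^ (m + n)) ⊆ Ω := fun m x hx n =>
    (Metric.ball_subset_ball
      (pow_le_pow_of_le_one (by norm_num) (by norm_num) (by omega))).trans hx
  have hstep : ∀ (m : ℕ) (x : Plane), Metric.ball x ((1 / 3 : ℝ) ^ m) ⊆ Ω → ∀ n : ℕ,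
      dist (a (m + n + 1) x) (a (m + (n + 1) + 1) x) ≤ 72 * √E₀ * p ^ n := by
    intro m x hx n
    have h1 := hr0 (m + n)
    have e1 := hrs (m + n)
    have e2 := hrs (m + n + 1)
    rw [dist_eq_norm, ← add_assoc m n 1, mul_assoc]
    refine (h.norm_setAverage_sub_setAverage_le hu hψ h1 (hsubΩ m x hx n) ?_ ?_ ?_ ?_).trans
      (mul_le_mul_of_nonneg_left (henergy m x hx n) (by norm_num))
    · linarith
    · linarith
    · exact Metric.closedBall_subset_ball (by linarith)
    · exact Metric.closedBall_subset_ball (by linarith)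
  have hnear : ∀ (m : ℕ) (x y : Plane), Metric.ball x ((1 / 3 : ℝ) ^ m) ⊆ Ω → ∀ n : ℕ,
      dist x y ≤ (1 / 3 : ℝ) ^ (m + n + 1) →
      dist (a (m + n + 1) x) (a (m + n + 1) y) ≤ 72 * √E₀ * p ^ n := by
    intro m x y hx n hxy
    have h1 := hr0 (m + n)
    have e1 := hrs (m + n)
    rw [dist_eq_norm, mul_assoc]
    refine (h.norm_setAverage_sub_setAverage_le hu hψ h1 (hsubΩ m x hx n) ?_ ?_ ?_ ?_).trans
      (mul_le_mul_of_nonneg_left (henergy m x hx n) (by norm_num))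
    · linarith
    · linarith
    · exact Metric.closedBall_subset_ball (by linarith)
    · refine Metric.closedBall_subset_ball' ?_
      rw [dist_comm]
      linarith
  set v : Plane → Plane := fun x => limUnder atTop fun k => a k x with hv
  have hlim : ∀ (m : ℕ) (x : Plane), Metric.ball x ((1 / 3 : ℝ) ^ m) ⊆ Ω → ∀ n : ℕ,
      dist (a (m + n + 1) x) (v x) ≤ 72 * √E₀ * p ^ n / (1 - p) := by
    intro m x hx n
    have hc := cauchySeq_of_le_geometric p (72 * √E₀) hp1 (hstep m x hx)
    obtain ⟨w, hw⟩ := cauchySeq_tendsto_of_complete hc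
    have hw' : Tendsto (fun k => a k x) atTop (𝓝 w) := by
      refine (tendsto_add_atTop_iff_nat (m + 1)).1 (hw.congr fun n => ?_)
      rw [show m + n + 1 = n + (m + 1) by ring]
    have hvw : v x = w := hw'.limUnder_eq
    rw [hvw]
    exact dist_le_of_le_geometric_of_tendsto p (72 * √E₀) hp1 (hstep m x hx) hw n
  refine ⟨v, ?_, fun K hK hKΩ => ?_⟩
  -- At a Lebesgue point of `u` in `Ω` the mean values converge to `u x`.
  · have hint : Integrable (Ω.indicator u) :=
      (integrable_indicator_iff hΩo.measurableSet).2 (hu.memLp.integrable (by norm_num))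
    rw [EventuallyEq, ae_restrict_iff' hΩo.measurableSet]
    filter_upwards [IsUnifLocDoublingMeasure.ae_tendsto_average volume hint.locallyIntegrable 1]
      with x hx hxΩ
    have hr : Tendsto (fun k : ℕ => (1 / 3 : ℝ) ^ k) atTop (𝓝[>] 0) :=
      tendsto_nhdsWithin_iff.2 ⟨tendsto_pow_atTop_nhds_zero_of_lt_one (by norm_num) (by norm_num),
        Eventually.of_forall hr0⟩
    have ht := hx (fun _ => x) (fun k : ℕ => (1 / 3 : ℝ) ^ k) hr
      (Eventually.of_forall fun k => Metric.mem_closedBall_self (by positivity))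
    rw [indicator_of_mem hxΩ] at ht
    obtain ⟨ε, hε, hεΩ⟩ := Metric.isOpen_iff.1 hΩo x hxΩ
    refine (Tendsto.limUnder_eq (ht.congr' ?_)).symm
    filter_upwards [(tendsto_nhdsWithin_iff.1 hr).1.eventually (gt_mem_nhds hε)] with k hk
    refine setAverage_congr_fun measurableSet_closedBall (Eventually.of_forall fun y hy => ?_)
    exact indicator_of_mem (hεΩ (Metric.closedBall_subset_ball hk hy)) u
  · obtain ⟨δ, hδ, hδΩ⟩ := hK.exists_thickening_subset_open hΩo hKΩ
    obtain ⟨m, hm⟩ := exists_pow_lt_of_lt_one hδ (by norm_num : (1 / 3 : ℝ) < 1)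
    have hball : ∀ x ∈ K, Metric.ball x ((1 / 3 : ℝ) ^ m) ⊆ Ω := fun x hx =>
      (Metric.ball_subset_ball hm.le).trans
        ((Metric.ball_subset_thickening hx δ).trans hδΩ)
    set D : ℝ := 72 * √E₀ * (2 / (1 - p) + 1) with hD
    have h1p : 0 < 1 - p := by linarith
    have hD0 : 0 ≤ D := by positivity
    refine exists_holderOnWith_of_forall_dist_le hK
      (C := D * ((1 / 3 : ℝ) ^ (m + 2))⁻¹ ^ (α : ℝ)) hα (hr0 (m + 1)) fun x hx y hy hxy => ?_
    rcases (dist_nonneg (x := x) (y := y)).eq_or_lt with h0 | h0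
    · have hxy0 : x = y := dist_eq_zero.1 h0.symm
      rw [hxy0, dist_self, dist_self, Real.zero_rpow hα'.ne', mul_zero]
    -- Choose the scale with `3⁻⁽ᵐ⁺ⁿ⁺²⁾ < dist x y ≤ 3⁻⁽ᵐ⁺ⁿ⁺¹⁾`.
    obtain ⟨n, hn1, hn2⟩ := exists_nat_pow_near_of_lt_one (div_pos h0 (hr0 (m + 1)))
      ((div_le_one (hr0 (m + 1))).2 hxy) (by norm_num : (0 : ℝ) < 1 / 3) (by norm_num)
    rw [lt_div_iff₀ (hr0 _), ← pow_add] at hn1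
    rw [div_le_iff₀ (hr0 _), ← pow_add] at hn2
    have hn2' : dist x y ≤ (1 / 3 : ℝ) ^ (m + n + 1) := by
      rwa [show m + n + 1 = n + (m + 1) by ring]
    have hpn : p ^ n ≤ ((1 / 3 : ℝ) ^ (m + 2))⁻¹ ^ (α : ℝ) * dist x y ^ (α : ℝ) := by
      rw [hp, ← Real.mul_rpow (by positivity) dist_nonneg, ← Real.rpow_natCast, ← Real.rpow_mul
        (by norm_num), mul_comm, Real.rpow_mul (by norm_num), Real.rpow_natCast]
      gcongr
      rw [inv_mul_eq_div, le_div_iff₀ (hr0 _), ← pow_add]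
      exact (show n + (m + 2) = n + 1 + (m + 1) by ring) ▸ hn1.le
    have d1 := hlim m x (hball x hx) n
    have d2 := hlim m y (hball y hy) n
    have d3 := hnear m x y (hball x hx) n hn2'
    calc dist (v x) (v y)
        ≤ dist (a (m + n + 1) x) (v x) + dist (a (m + n + 1) x) (a (m + n + 1) y) +
          dist (a (m + n + 1) y) (v y) := by
          rw [dist_comm (a (m + n + 1) x) (v x)]
          exact dist_triangle4 _ _ _ _
      _ ≤ 72 * √E₀ * p ^ n / (1 - p) + 72 * √E₀ * p ^ n + 72 * √E₀ * p ^ n / (1 - p) := by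
          gcongr
      _ = D * p ^ n := by rw [hD]; ring
      _ ≤ _ := by
          rw [mul_assoc D]
          exact mul_le_mul_of_nonneg_left hpn hD0

/-! ### Hölder continuity of stationary points -/

theorem theorem1p2 (γ : ℝ) (hγ : 0 < γ) :
    ∃ α : ℝ≥0, 0 < α ∧ α < 1 ∧
      ∀ (Ω : Set Plane), IsOpen Ω → Bornology.IsBounded Ω → HasLipschitzBoundary Ω →
      ∀ (s₀ κ : ℝ) (ρ : ℝ → ℝ), IsDensity γ s₀ κ ρ →
      ∀ (u₀ u : Plane → Plane), IsStationaryPoint Ω ρ u₀ u → IsLocallyHolder Ω α u := by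
  obtain ⟨θ, hθ1, hdecay⟩ := exists_integral_ball_le_mul_integral_ball γ
  -- Since `θ < 1`, a small exponent satisfies `θ ≤ 3⁻²ᵅ`.
  have hlim : Tendsto (fun a : ℝ => ((1 / 3 : ℝ) ^ a) ^ 2) (𝓝[>] 0) (𝓝 1) := by
    have hc : ContinuousAt (fun a : ℝ => ((1 / 3 : ℝ) ^ a) ^ 2) 0 :=
      (Real.continuousAt_const_rpow (by norm_num)).pow 2
    simpa using hc.tendsto.mono_left nhdsWithin_le_nhds
  obtain ⟨a, ⟨haθ, ha1⟩, ha0⟩ := ((hlim.eventually (lt_mem_nhds hθ1)).and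
    (mem_nhdsWithin_of_mem_nhds (Iio_mem_nhds zero_lt_one)) |>.and self_mem_nhdsWithin).exists
  refine ⟨⟨a, (mem_Ioi.1 ha0).le⟩, mem_Ioi.1 ha0, mem_Iio.1 ha1, ?_⟩
  rintro Ω hΩo hΩb - s₀ κ ρ hρ u₀ u ⟨G, hu, ⟨-, ψ, hψ, hψu, -⟩, hEL⟩
  have hfin : volume Ω ≠ ⊤ := hΩb.measure_lt_top.ne
  exact hψu.isLocallyHolder hΩo hfin hu hψ (mem_Ioi.1 ha0) haθ.le
    (hdecay Ω hΩo.measurableSet hfin s₀ κ ρ hρ u G ψ hu hψ hψu hEL)
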